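/- Fix $0<p<1/2$ and $0<\alpha<1$; logarithms are to base $2$. For integers $n\ge 1$ and $0\le k<m$, let $\mathcal C\in\{0,1\}^{m\times n}$ be a codebook with rows $c_1,\dots,c_m$ (not necessarily distinct). Let $\pi$ be uniformly distributed on the set of injective maps $\{1,\dots,m-k\}\to\{1,\dots,m\}$, and, given $\pi$, let $\tilde{\mathcal C}\in\{0,1\}^{(m-k)\times n}$ have independent rows, the $i$-th row $\tilde c_i$ being the output of a binary symmetric channel with crossover probability $p$ on input $c_{\pi(i)}$, i.e. $\Pr\{\tilde c_i\mid c_{\pi(i)}\}=p^{d_i}(1-p)^{n-d_i}$ with $d_i$ the Hamming distance between $\tilde c_i$ and $c_{\pi(i)}$. A decoder $\phi$ maps each possible value of $\tilde{\mathcal C}$ to a map $\{1,\dots,m-k\}\to\{1,\dots,m\}$. Put $$\underline D(n,m,p,k)=\min_{\mathcal C,\phi}\Pr\{\phi(\tilde{\mathcal C})\ne\pi\},$$ the minimum being over all codebooks $\mathcal C\in\{0,1\}^{m\times n}$ and all decoders $\phi$. For $R>0$ define the bee-identification error exponent $$E_{\underline D}(R,p,\alpha)=\limsup_{n\to\infty}-\frac1n\log\underline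 D(n,m,p,k),\qquad m=\lceil 2^{nR}\rceil,\quad k=\lfloor\alpha m\rfloor .$$ Let $B_p=-\log\sqrt{4p(1-p)}$ be the Bhattacharyya parameter and let $$R_{\mathrm{cr}}=1-H\!\left(\frac{\sqrt p}{\sqrt p+\sqrt{1-p}}\right),\qquad H(x)=-x\log x-(1-x)\log(1-x),$$ be the critical rate of the channel. Then $$\lim_{R\downarrow 0}E_{\underline D}(R,p,\alpha)=\frac{B_p}{2},$$ and $E_{\underline D}(R,p,\alpha)=0$ for every $R\ge R_{\mathrm{cr}}$. -/

import Mathlib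

open Filter Topology

namespace Bee

/-- A binary codebook with `m` rows (barcodes), each of length `n`; rows may coincide. -/
abbrev Codebook (n m : ℕ) : Type := Fin m → Fin n → Bool

/-- The channel output: `r` noisy rows of length `n`. -/
abbrev Received (n r : ℕ) : Type := Fin r → Fin n → Bool

/-- A decoder maps the channel output to a map from the `m - k` received rows to the `m` barcode
indices. It may depend on the codebook, since codebook and decoder are minimized over jointly. -/
abbrev Decoder (n m k : ℕ) : Type := Received n (m - k) → (Fin (m - k) → Fin m)

/-- Probability that the binary symmetric channel with crossover probability `p` outputs `y`
when the word `x` is sent. -/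
noncomputable def bscProb {n : ℕ} (p : ℝ) (x y : Fin n → Bool) : ℝ :=
  p ^ hammingDist y x * (1 - p) ^ (n - hammingDist y x)

/-- Probability of the channel output `Y` when the rows of `C` selected by the injection `σ` are
sent, independently, over the binary symmetric channel. -/
noncomputable def outputProb {n m r : ℕ} (p : ℝ) (C : Codebook n m) (σ : Fin r ↪ Fin m)
    (Y : Received n r) : ℝ :=
  ∏ i, bscProb p (C (σ i)) (Y i)

open Classical in
/-- Probability that the decoder `φ` does not output exactly `σ`, given that `σ` is the
channel-induced injection. -/
noncomputable def condErrorProb {n m k : ℕ} (C : Codebook n m) (p : ℝ) (φ : Decoder n m k)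
    (σ : Fin (m - k) ↪ Fin m) : ℝ :=
  ∑ Y : Received n (m - k), if φ Y ≠ ⇑σ then outputProb p C σ Y else 0

/-- Expected bee-identification error probability: the average of `condErrorProb` over the uniform
distribution on injections from the `m - k` present bees to the `m` indices. -/
noncomputable def errorProb {n m : ℕ} (C : Codebook n m) (p : ℝ) (k : ℕ)
    (φ : Decoder n m k) : ℝ :=
  (∑ σ : Fin (m - k) ↪ Fin m, condErrorProb C p φ σ) / (Fintype.card (Fin (m - k) ↪ Fin m) : ℝ)

/-- Minimum expected bee-identification error probability over all codebooks and decoders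
(an infimum over a finite nonempty type, hence a minimum). -/
noncomputable def minErrorProb (n m : ℕ) (p : ℝ) (k : ℕ) : ℝ :=
  ⨅ x : Codebook n m × Decoder n m k, errorProb x.1 p k x.2

/-- Number of bees at rate `R` and barcode length `n`: `⌈2 ^ (n R)⌉`. -/
noncomputable def numBees (R : ℝ) (n : ℕ) : ℕ := ⌈(2 : ℝ) ^ ((n : ℝ) * R)⌉₊

/-- Number of absentee bees, `⌊α m⌋`, when a fraction `α` of the `m` bees is absent. -/
noncomputable def numAbsent (α : ℝ) (m : ℕ) : ℕ := ⌊α * (m : ℝ)⌋₊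

/-- The bee-identification error exponent with absentee fraction `α` at rate `R`, as a limit
superior in the extended reals, so that no boundedness is presupposed. For `0 < p < 1`, `0 < α < 1`,
`0 < R` and `1 ≤ n` there are at least two injections, each of which gives every output positive
probability, so the argument of the logarithm is positive. -/
noncomputable def exponent (R p α : ℝ) : EReal :=
  limsup (fun n : ℕ =>
    ((-(1 / (n : ℝ)) *
      Real.logb 2 (minErrorProb n (numBees R n) p (numAbsent α (numBees R n))) : ℝ) : EReal)) atTop

/-- The Bhattacharyya parameter of the binary symmetric channel, in bits. -/
noncomputable def bhattacharyya (p : ℝ) : ℝ := -Real.logb 2 (Real.sqrt (4 * p * (1 - p)))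

/-- The binary entropy function, in bits. -/
noncomputable def entropyBits (x : ℝ) : ℝ :=
  -(x * Real.logb 2 x) - (1 - x) * Real.logb 2 (1 - x)

/-- The critical rate of the binary symmetric channel. -/
noncomputable def criticalRate (p : ℝ) : ℝ :=
  1 - entropyBits (Real.sqrt p / (Real.sqrt p + Real.sqrt (1 - p)))

end Bee

/-!
The upper bounds on the exponent come from one converse for joint decoding with absentees. Call an
output ambiguous for the injection `σ` when some received row is at least as close to the codeword
of an absent bee as to the codeword that was sent. Moving that one bee to the absent codeword gives
a different injection that is at least as likely, so whatever the decoder answers, at least half of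
the probability of ambiguous outputs is error (`Bee.sum_ambiguous_le`). Given `σ`, the rows are
independent; and a uniformly distributed `σ`, conditioned on all rows but one, picks the codeword
of that row uniformly from a set `T` of `k + 1` candidates. Hence if every `T` of that size is so
poor a code that half of its members are confused with probability at least `β`, the identification
error is at least of order `min 1 ((m - k) β)` (`Bee.le_errorProb_of_confusionProb`).

For low rates, Plotkin's bound finds in every large `T` neighbours at distance about `n / 2`, and
two codewords at distance `d` are confused with probability `2 ^ (-d B_p)` up to a polynomial
factor. Thus the exponent is at most `B_p / 2` at every positive rate
(`Bee.exponent_le_half_bhattacharyya`).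

For rates from `R_cr` on, let `δ = √p / (√p + √(1 - p))`. Spheres of radius `x n` with `x` slightly
above `δ` around the codewords of `T` overfill the space, so half of them consist of confusable
words to one half, and a codeword is confused with probability `β` at least about
`2 ^ (n H(x)) p ^ (x n) (1 - p) ^ ((1 - x) n)`. The strict inequality
`-δ log p - (1 - δ) log (1 - p) < 1`, a comparison of Shannon and collision entropy
(`Bee.neg_log_criticalCrossover_lt`), makes the last two factors at least `2 ^ (-n)`, while
`R + H(x) > 1`; so `(m - k) β` is at least `1` eventually and the error stays above `1 / 8`.

The lower bound `(1 / 2 - √R) B_p - 2 R` on the exponent (`Bee.le_exponent`) is achieved by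
Gilbert–Varshamov codebooks of minimum distance `(1 / 2 - √R) n`, decoding each row separately and
using the Bhattacharyya union bound. Both bounds tend to `B_p / 2` as the rate decreases to `0`.
-/

namespace Bee

/-! ### The channel and the error probability -/

theorem bscProb_eq_prod {n : ℕ} (p : ℝ) (x y : Fin n → Bool) :
    bscProb p x y = ∏ i, if y i ≠ x i then p else 1 - p := by
  have h : (Finset.univ.filter fun i => ¬ y i ≠ x i).card
      = n - (Finset.univ.filter fun i => y i ≠ x i).card := by
    have := Finset.card_filter_add_card_filter_not (s := (Finset.univ : Finset (Fin n)))
      (fun i => y i ≠ x i)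
    simp only [Finset.card_univ, Fintype.card_fin] at this
    omega
  rw [Finset.prod_ite, Finset.prod_const, Finset.prod_const, h]
  rfl

theorem bscProb_nonneg {n : ℕ} {p : ℝ} (hp0 : 0 ≤ p) (hp1 : p ≤ 1) (x y : Fin n → Bool) :
    0 ≤ bscProb p x y :=
  mul_nonneg (pow_nonneg hp0 _) (pow_nonneg (sub_nonneg.2 hp1) _)

theorem outputProb_nonneg {n m r : ℕ} {p : ℝ} (hp0 : 0 ≤ p) (hp1 : p ≤ 1) (C : Codebook n m)
    (σ : Fin r ↪ Fin m) (Y : Received n r) : 0 ≤ outputProb p C σ Y :=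
  Finset.prod_nonneg fun _ _ => bscProb_nonneg hp0 hp1 _ _

theorem sum_bscProb_piFinset {n : ℕ} (p : ℝ) (x : Fin n → Bool) (G : Fin n → Finset Bool) :
    ∑ y ∈ Fintype.piFinset G, bscProb p x y
      = ∏ i, ∑ b ∈ G i, if b ≠ x i then p else 1 - p := by
  rw [Finset.prod_univ_sum]
  exact Finset.sum_congr rfl fun y _ => bscProb_eq_prod p x y

theorem sum_bscProb {n : ℕ} (p : ℝ) (x : Fin n → Bool) : ∑ y, bscProb p x y = 1 := by
  have h := sum_bscProb_piFinset p x fun _ => Finset.univ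
  rw [Fintype.piFinset_univ] at h
  rw [h]
  refine Finset.prod_eq_one fun i _ => ?_
  cases x i <;> simp

theorem sum_outputProb_piFinset {n m r : ℕ} (p : ℝ) (C : Codebook n m) (σ : Fin r ↪ Fin m)
    (G : Fin r → Finset (Fin n → Bool)) :
    ∑ Y ∈ Fintype.piFinset G, outputProb p C σ Y = ∏ i, ∑ y ∈ G i, bscProb p (C (σ i)) y := by
  rw [Finset.prod_univ_sum]
  rfl

theorem sum_outputProb {n m r : ℕ} (p : ℝ) (C : Codebook n m) (σ : Fin r ↪ Fin m) :
    ∑ Y, outputProb p C σ Y = 1 := by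
  have h := sum_outputProb_piFinset p C σ fun _ => Finset.univ
  rw [Fintype.piFinset_univ] at h
  rw [h]
  exact Finset.prod_eq_one fun i _ => sum_bscProb p _

theorem hammingDist_le_length {n : ℕ} (x y : Fin n → Bool) : hammingDist x y ≤ n := by
  simpa using hammingDist_le_card_fintype (x := x) (y := y)

/-- For crossover probability at most `1 / 2`, likelihood decreases with Hamming distance. -/
theorem bscProb_le_of_hammingDist_le {n : ℕ} {p : ℝ} (hp0 : 0 ≤ p) (hp1 : p ≤ 1 / 2)
    {x x' y : Fin n → Bool} (h : hammingDist y x' ≤ hammingDist y x) :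
    bscProb p x y ≤ bscProb p x' y := by
  unfold bscProb
  have hn := hammingDist_le_length y x
  obtain ⟨e, he⟩ := Nat.exists_eq_add_of_le h
  obtain ⟨f, hf⟩ := Nat.exists_eq_add_of_le hn
  generalize hammingDist y x = a at *
  generalize hammingDist y x' = b at *
  subst he
  have h1 : n - (b + e) = f := by omega
  have h2 : n - b = f + e := by omega
  rw [h1, h2, pow_add, pow_add]
  have h3 : p ^ e ≤ (1 - p) ^ e := pow_le_pow_left₀ hp0 (by linarith) e
  have h4 : 0 ≤ p ^ b * (1 - p) ^ f := mul_nonneg (pow_nonneg hp0 _) (pow_nonneg (by linarith) _)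
  calc p ^ b * p ^ e * (1 - p) ^ f = p ^ b * (1 - p) ^ f * p ^ e := by ring
    _ ≤ p ^ b * (1 - p) ^ f * (1 - p) ^ e := mul_le_mul_of_nonneg_left h3 h4
    _ = _ := by ring

theorem condErrorProb_eq {n m k : ℕ} (C : Codebook n m) (p : ℝ) (φ : Decoder n m k)
    (σ : Fin (m - k) ↪ Fin m) :
    condErrorProb C p φ σ
      = 1 - ∑ Y, open Classical in if φ Y = ⇑σ then outputProb p C σ Y else 0 := by
  classical
  rw [← sum_outputProb p C σ, ← Finset.sum_sub_distrib]
  refine Finset.sum_congr rfl fun Y _ => ?_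
  by_cases h : φ Y = ⇑σ <;> simp [h]

theorem condErrorProb_nonneg {n m k : ℕ} (C : Codebook n m) {p : ℝ} (hp0 : 0 ≤ p) (hp1 : p ≤ 1)
    (φ : Decoder n m k) (σ : Fin (m - k) ↪ Fin m) : 0 ≤ condErrorProb C p φ σ := by
  refine Finset.sum_nonneg fun Y _ => ?_
  split_ifs
  exacts [outputProb_nonneg hp0 hp1 C σ Y, le_rfl]

theorem condErrorProb_le_one {n m k : ℕ} (C : Codebook n m) {p : ℝ} (hp0 : 0 ≤ p) (hp1 : p ≤ 1)
    (φ : Decoder n m k) (σ : Fin (m - k) ↪ Fin m) : condErrorProb C p φ σ ≤ 1 := by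
  rw [condErrorProb_eq, sub_le_self_iff]
  refine Finset.sum_nonneg fun Y _ => ?_
  split_ifs
  exacts [outputProb_nonneg hp0 hp1 C σ Y, le_rfl]

theorem card_embedding_pos (m k : ℕ) : 0 < Fintype.card (Fin (m - k) ↪ Fin m) :=
  Fintype.card_pos_iff.2 ⟨Fin.castLEEmb (Nat.sub_le m k)⟩

theorem errorProb_nonneg {n m k : ℕ} (C : Codebook n m) {p : ℝ} (hp0 : 0 ≤ p) (hp1 : p ≤ 1)
    (φ : Decoder n m k) : 0 ≤ errorProb C p k φ :=
  div_nonneg (Finset.sum_nonneg fun _ _ => condErrorProb_nonneg C hp0 hp1 φ _) (Nat.cast_nonneg _)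

theorem errorProb_le_of_forall {n m k : ℕ} {C : Codebook n m} {p c : ℝ} {φ : Decoder n m k}
    (h : ∀ σ, condErrorProb C p φ σ ≤ c) : errorProb C p k φ ≤ c := by
  have h0 : (0 : ℝ) < Fintype.card (Fin (m - k) ↪ Fin m) := by exact_mod_cast card_embedding_pos m k
  rw [errorProb, div_le_iff₀ h0]
  refine (Finset.sum_le_sum fun σ _ => h σ).trans (le_of_eq ?_)
  simp [mul_comm]

theorem minErrorProb_le {n m k : ℕ} {p : ℝ} (hp0 : 0 ≤ p) (hp1 : p ≤ 1) (C : Codebook n m)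
    (φ : Decoder n m k) : minErrorProb n m p k ≤ errorProb C p k φ :=
  ciInf_le ⟨0, by rintro _ ⟨x, rfl⟩; exact errorProb_nonneg x.1 hp0 hp1 x.2⟩ (C, φ)

theorem minErrorProb_le_one {n m k : ℕ} {p : ℝ} (hp0 : 0 ≤ p) (hp1 : p ≤ 1) :
    minErrorProb n m p k ≤ 1 :=
  (minErrorProb_le hp0 hp1 (fun _ _ => false) fun _ => Fin.castLE (Nat.sub_le m k)).trans
    (errorProb_le_of_forall fun _ => condErrorProb_le_one _ hp0 hp1 _ _)

theorem le_minErrorProb {n m k : ℕ} {p c : ℝ}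
    (h : ∀ (C : Codebook n m) (φ : Decoder n m k), c ≤ errorProb C p k φ) :
    c ≤ minErrorProb n m p k :=
  haveI : Nonempty (Codebook n m × Decoder n m k) :=
    ⟨(fun _ _ => false, fun _ => Fin.castLE (Nat.sub_le m k))⟩
  le_ciInf fun x => h x.1 x.2

/-! ### Ambiguous outputs and the converse for joint decoding -/

/-- The codewords that may be sent in row `i` when the other rows are sent as prescribed by `σ`:
the absent ones, together with `σ i` itself. -/
def candidates {r m : ℕ} (σ : Fin r ↪ Fin m) (i : Fin r) : Finset (Fin m) :=
  Finset.univ.filter fun t => ∀ j, j ≠ i → σ j ≠ t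

theorem mem_candidates {r m : ℕ} {σ : Fin r ↪ Fin m} {i : Fin r} {t : Fin m} :
    t ∈ candidates σ i ↔ ∀ j, j ≠ i → σ j ≠ t := by
  simp [candidates]

theorem card_candidates {r m : ℕ} (σ : Fin r ↪ Fin m) (i : Fin r) :
    (candidates σ i).card = m - r + 1 := by
  classical
  have h : candidates σ i = (((Finset.univ : Finset (Fin r)).erase i).map σ)ᶜ := by
    ext t
    simp only [mem_candidates, Finset.mem_compl, Finset.mem_map, Finset.mem_erase,
      Finset.mem_univ, and_true, not_exists, not_and]
  have hr : r ≤ m := by simpa using Fintype.card_le_of_embedding σ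
  have hi : 0 < r := i.pos
  rw [h, Finset.card_compl, Finset.card_map, Finset.card_erase_of_mem (Finset.mem_univ i)]
  simp only [Fintype.card_fin, Finset.card_univ]
  omega

theorem setValue_apply_of_ne {r m : ℕ} {σ : Fin r ↪ Fin m} {i j : Fin r} {t : Fin m}
    (ht : t ∈ candidates σ i) (hj : j ≠ i) : σ.setValue i t j = σ j :=
  Function.Embedding.setValue_eq_of_ne hj (mem_candidates.1 ht j hj)

theorem candidates_congr {r m : ℕ} {σ τ : Fin r ↪ Fin m} {i : Fin r}
    (h : ∀ j, j ≠ i → τ j = σ j) : candidates τ i = candidates σ i := by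
  ext t
  simp only [mem_candidates]
  exact forall₂_congr fun j hj => by rw [h j hj]

open Classical in
/-- The injections that agree with `σ` off row `i` are indexed by their value there. -/
theorem card_filter_agree_off {r m : ℕ} (σ : Fin r ↪ Fin m) (i : Fin r)
    (P : Finset (Fin m) → Fin m → Prop) :
    (Finset.univ.filter fun τ : Fin r ↪ Fin m =>
        (∀ j, j ≠ i → τ j = σ j) ∧ P (candidates τ i) (τ i)).card
      = ((candidates σ i).filter fun t => P (candidates σ i) t).card := by
  refine Finset.card_bij' (fun τ _ => τ i) (fun t _ => σ.setValue i t) ?_ ?_ ?_ ?_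
  · intro τ hτ
    obtain ⟨h1, h2⟩ := (Finset.mem_filter.1 hτ).2
    rw [candidates_congr h1] at h2
    refine Finset.mem_filter.2 ⟨mem_candidates.2 fun j hj => ?_, h2⟩
    rw [← h1 j hj]
    exact τ.injective.ne hj
  · intro t ht
    obtain ⟨h1, h2⟩ := Finset.mem_filter.1 ht
    refine Finset.mem_filter.2 ⟨Finset.mem_univ _, fun j hj => setValue_apply_of_ne h1 hj, ?_⟩
    rw [candidates_congr fun j hj => setValue_apply_of_ne h1 hj, Function.Embedding.setValue_eq]
    exact h2
  · intro τ hτ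
    obtain ⟨h1, -⟩ := (Finset.mem_filter.1 hτ).2
    have hc : τ i ∈ candidates σ i := mem_candidates.2 fun j hj => by
      rw [← h1 j hj]
      exact τ.injective.ne hj
    ext j : 1
    by_cases hj : j = i
    · subst hj
      rw [Function.Embedding.setValue_eq]
    · rw [setValue_apply_of_ne hc hj, h1 j hj]
  · intro t _
    exact Function.Embedding.setValue_eq _ _ _

open Classical in
/-- If in every set of `m - r + 1` codewords at least half have the property `P`, then for a
uniformly distributed injection `σ` the codeword `σ i` has it, within its set of candidates, with
probability at least `1 / 2`: the injections that agree off row `i` are equally likely. -/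
theorem card_embedding_le_two_mul_card_filter {r m : ℕ} (i : Fin r)
    (P : Finset (Fin m) → Fin m → Prop)
    (h : ∀ T : Finset (Fin m), T.card = m - r + 1 → m - r + 1 ≤ 2 * (T.filter (P T)).card) :
    Fintype.card (Fin r ↪ Fin m)
      ≤ 2 * (Finset.univ.filter fun σ : Fin r ↪ Fin m => P (candidates σ i) (σ i)).card := by
  set K := m - r + 1 with hK
  have key : ∑ σ : Fin r ↪ Fin m, (Finset.univ.filter fun τ : Fin r ↪ Fin m =>
        (∀ j, j ≠ i → τ j = σ j) ∧ P (candidates τ i) (τ i)).card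
      = K * (Finset.univ.filter fun σ : Fin r ↪ Fin m => P (candidates σ i) (σ i)).card := by
    simp_rw [Finset.card_filter _ Finset.univ]
    rw [Finset.sum_comm, Finset.mul_sum]
    refine Finset.sum_congr rfl fun τ _ => ?_
    by_cases hP : P (candidates τ i) (τ i)
    · simp only [hP, and_true, if_true, mul_one]
      have h1 := card_filter_agree_off τ i fun _ _ => True
      simp only [and_true, Finset.filter_true, card_candidates, Finset.card_filter] at h1
      rw [hK, ← h1]
      exact Finset.sum_congr rfl fun σ _ => by simp only [eq_comm]
    · simp [hP]
  have h2 : ∑ _σ : Fin r ↪ Fin m, K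
      ≤ ∑ σ : Fin r ↪ Fin m, 2 * (Finset.univ.filter fun τ : Fin r ↪ Fin m =>
        (∀ j, j ≠ i → τ j = σ j) ∧ P (candidates τ i) (τ i)).card := by
    refine Finset.sum_le_sum fun σ _ => ?_
    rw [card_filter_agree_off σ i P]
    exact h _ (card_candidates σ i)
  rw [← Finset.mul_sum, key, Finset.sum_const, Finset.card_univ, smul_eq_mul] at h2
  have hK0 : 0 < K := Nat.succ_pos _
  refine Nat.le_of_mul_le_mul_right (h2.trans (le_of_eq ?_)) hK0
  ring

/-- The received words that are at least as close to some other codeword of `T` as to the codeword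
with index `s`. -/
def confusable {n m : ℕ} (C : Codebook n m) (T : Finset (Fin m)) (s : Fin m) :
    Finset (Fin n → Bool) :=
  Finset.univ.filter fun y => ∃ t ∈ T, t ≠ s ∧ hammingDist y (C t) ≤ hammingDist y (C s)

/-- The probability that minimum-distance decoding to `T` is not unambiguously correct when the
codeword with index `s` is sent: ties count as errors. -/
noncomputable def confusionProb {n m : ℕ} (p : ℝ) (C : Codebook n m) (T : Finset (Fin m))
    (s : Fin m) : ℝ :=
  ∑ y ∈ confusable C T s, bscProb p (C s) y

theorem mem_confusable {n m : ℕ} {C : Codebook n m} {T : Finset (Fin m)} {s : Fin m}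
    {y : Fin n → Bool} :
    y ∈ confusable C T s ↔ ∃ t ∈ T, t ≠ s ∧ hammingDist y (C t) ≤ hammingDist y (C s) := by
  simp [confusable]

theorem confusionProb_nonneg {n m : ℕ} {p : ℝ} (hp0 : 0 ≤ p) (hp1 : p ≤ 1) (C : Codebook n m)
    (T : Finset (Fin m)) (s : Fin m) : 0 ≤ confusionProb p C T s :=
  Finset.sum_nonneg fun _ _ => bscProb_nonneg hp0 hp1 _ _

theorem sum_compl_confusable {n m : ℕ} (p : ℝ) (C : Codebook n m) (T : Finset (Fin m))
    (s : Fin m) :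
    ∑ y ∈ (confusable C T s)ᶜ, bscProb p (C s) y = 1 - confusionProb p C T s := by
  rw [← sum_bscProb p (C s), ← Finset.sum_compl_add_sum (confusable C T s)]
  simp [confusionProb]

theorem confusionProb_le_one {n m : ℕ} {p : ℝ} (hp0 : 0 ≤ p) (hp1 : p ≤ 1) (C : Codebook n m)
    (T : Finset (Fin m)) (s : Fin m) : confusionProb p C T s ≤ 1 := by
  rw [← sub_nonneg, ← sum_compl_confusable]
  exact Finset.sum_nonneg fun _ _ => bscProb_nonneg hp0 hp1 _ _

/-- The channel outputs for which some row is at least as close to an absent codeword as to the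
codeword sent. -/
def ambiguous {n m r : ℕ} (C : Codebook n m) (σ : Fin r ↪ Fin m) : Finset (Received n r) :=
  (Fintype.piFinset fun i => (confusable C (candidates σ i) (σ i))ᶜ)ᶜ

theorem exists_outputProb_le {n m r : ℕ} {p : ℝ} (hp0 : 0 ≤ p) (hp1 : p ≤ 1 / 2)
    {C : Codebook n m} {σ : Fin r ↪ Fin m} {Y : Received n r} (hY : Y ∈ ambiguous C σ) :
    ∃ τ, τ ≠ σ ∧ outputProb p C σ Y ≤ outputProb p C τ Y := by
  simp only [ambiguous, Finset.mem_compl, Fintype.mem_piFinset, not_forall, not_not] at hY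
  obtain ⟨i, hi⟩ := hY
  obtain ⟨t, htT, hts, hd⟩ := mem_confusable.1 hi
  refine ⟨σ.setValue i t, fun h => hts ?_, Finset.prod_le_prod
    (fun j _ => bscProb_nonneg hp0 (by linarith) _ _) fun j _ => ?_⟩
  · rw [← Function.Embedding.setValue_eq σ i t, h]
  · by_cases hj : j = i
    · subst hj
      rw [Function.Embedding.setValue_eq]
      exact bscProb_le_of_hammingDist_le hp0 hp1 hd
    · rw [setValue_apply_of_ne htT hj]

/-- Whatever the decoder, an output that is ambiguous for `σ` costs at least half its probability:
the decoder outputs `σ` or the competitor, and the competitor is no less likely. -/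
theorem sum_ambiguous_le {n m k : ℕ} {p : ℝ} (hp0 : 0 ≤ p) (hp1 : p ≤ 1 / 2)
    (C : Codebook n m) (φ : Decoder n m k) :
    ∑ σ : Fin (m - k) ↪ Fin m, ∑ Y ∈ ambiguous C σ, outputProb p C σ Y
      ≤ 2 * ∑ σ : Fin (m - k) ↪ Fin m, condErrorProb C p φ σ := by
  classical
  have hnn := fun (σ : Fin (m - k) ↪ Fin m) Y => outputProb_nonneg hp0 (by linarith) C σ Y
  have h1 : ∀ σ : Fin (m - k) ↪ Fin m, ∑ Y ∈ ambiguous C σ, outputProb p C σ Y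
      = ∑ Y, if Y ∈ ambiguous C σ then outputProb p C σ Y else 0 := fun σ => by
    rw [Finset.sum_ite_mem, Finset.univ_inter]
  simp_rw [h1, condErrorProb]
  rw [Finset.sum_comm, Finset.sum_comm (s := (Finset.univ : Finset (Fin (m - k) ↪ Fin m)))
    (f := fun σ Y => if φ Y ≠ ⇑σ then outputProb p C σ Y else 0), Finset.mul_sum]
  refine Finset.sum_le_sum fun Y _ => ?_
  set e : (Fin (m - k) ↪ Fin m) → ℝ := fun σ : Fin (m - k) ↪ Fin m =>
    if φ Y ≠ ⇑σ then outputProb p C σ Y else 0 with he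
  have he0 : ∀ σ : Fin (m - k) ↪ Fin m, 0 ≤ e σ := fun σ => by
    simp only [he]
    split_ifs
    exacts [hnn σ Y, le_rfl]
  have hle : ∀ σ : Fin (m - k) ↪ Fin m, φ Y ≠ ⇑σ →
      (if Y ∈ ambiguous C σ then outputProb p C σ Y else 0) ≤ e σ := fun σ hσ => by
    simp only [he, if_pos hσ]
    split_ifs
    exacts [le_rfl, hnn σ Y]
  by_cases hφ : ∃ σ : Fin (m - k) ↪ Fin m, φ Y = ⇑σ
  · obtain ⟨σ₀, h0⟩ := hφ
    have hne : ∀ σ : Fin (m - k) ↪ Fin m, σ ≠ σ₀ → φ Y ≠ ⇑σ := fun σ hσ h =>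
      hσ (DFunLike.coe_injective (h.symm.trans h0))
    have h2 : (if Y ∈ ambiguous C σ₀ then outputProb p C σ₀ Y else 0) ≤ ∑ σ, e σ := by
      split_ifs with hY
      · obtain ⟨τ, hτ, hle'⟩ := exists_outputProb_le hp0 hp1 hY
        refine hle'.trans (le_trans (le_of_eq ?_)
          (Finset.single_le_sum (fun σ _ => he0 σ) (Finset.mem_univ τ)))
        simp only [he, if_pos (hne τ hτ)]
      · exact Finset.sum_nonneg fun σ _ => he0 σ
    rw [← Finset.add_sum_erase _ _ (Finset.mem_univ σ₀), two_mul]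
    refine add_le_add h2 ((Finset.sum_le_sum fun σ hσ =>
      hle σ (hne σ (Finset.ne_of_mem_erase hσ))).trans
      (Finset.sum_le_sum_of_subset_of_nonneg (Finset.subset_univ _) fun σ _ _ => he0 σ))
  · push Not at hφ
    refine (Finset.sum_le_sum fun σ _ => hle σ (hφ σ)).trans ?_
    have := Finset.sum_nonneg fun σ (_ : σ ∈ Finset.univ) => he0 σ
    linarith

/-- The rows are independent, so confusion in any of them has probability `1 - ∏ i, (1 - q i)`,
which is bounded below through `1 - x ≤ exp (-x)` and `exp (-s) ≤ 1 / (1 + s)`. -/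
theorem le_sum_ambiguous {n m r : ℕ} {p β : ℝ} (hp0 : 0 ≤ p) (hp1 : p ≤ 1) (hβ : 0 ≤ β)
    (C : Codebook n m) (σ : Fin r ↪ Fin m) :
    (∑ i, if β ≤ confusionProb p C (candidates σ i) (σ i) then β else 0) / (1 + r * β)
      ≤ ∑ Y ∈ ambiguous C σ, outputProb p C σ Y := by
  set b : Fin r → ℝ := fun i => if β ≤ confusionProb p C (candidates σ i) (σ i) then β else 0
    with hb
  have hb0 : 0 ≤ ∑ i, b i := Finset.sum_nonneg fun i _ => by
    simp only [hb]
    split_ifs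
    exacts [hβ, le_rfl]
  have hbr : ∑ i, b i ≤ r * β := by
    refine (Finset.sum_le_card_nsmul _ _ β fun i _ => ?_).trans (by simp)
    simp only [hb]
    split_ifs
    exacts [le_rfl, hβ]
  have h1 : ∑ Y ∈ ambiguous C σ, outputProb p C σ Y
      = 1 - ∏ i, (1 - confusionProb p C (candidates σ i) (σ i)) := by
    have h := Finset.sum_compl_add_sum
      (Fintype.piFinset fun i => (confusable C (candidates σ i) (σ i))ᶜ) (outputProb p C σ)
    rw [sum_outputProb, sum_outputProb_piFinset] at h
    simp_rw [sum_compl_confusable] at h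
    exact eq_sub_of_add_eq h
  have h2 : ∏ i, (1 - confusionProb p C (candidates σ i) (σ i)) ≤ Real.exp (-∑ i, b i) := by
    rw [← Finset.sum_neg_distrib, Real.exp_sum]
    refine Finset.prod_le_prod (fun i _ => sub_nonneg.2 (confusionProb_le_one hp0 hp1 _ _ _))
      fun i _ => ?_
    have h3 : b i ≤ confusionProb p C (candidates σ i) (σ i) := by
      simp only [hb]
      split_ifs with h
      exacts [h, confusionProb_nonneg hp0 hp1 _ _ _]
    have h4 := Real.add_one_le_exp (-b i)
    linarith
  have h5 : Real.exp (-∑ i, b i) ≤ 1 / (1 + ∑ i, b i) := by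
    rw [Real.exp_neg, ← one_div]
    have := Real.add_one_le_exp (∑ i, b i)
    exact one_div_le_one_div_of_le (by linarith) (by linarith)
  have h6 : (∑ i, b i) / (1 + r * β) ≤ (∑ i, b i) / (1 + ∑ i, b i) :=
    div_le_div_of_nonneg_left hb0 (by linarith) (by linarith)
  have h7 : 1 - 1 / (1 + ∑ i, b i) = (∑ i, b i) / (1 + ∑ i, b i) := by
    field_simp
    ring
  rw [h1]
  linarith

/-- Converse for joint decoding with absentees: if every set of `k + 1` codewords is so poor a code
that half of its members are confused with probability at least `β`, then the identification error
is at least of order `min 1 ((m - k) β)`. -/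
theorem le_errorProb_of_confusionProb {n m k : ℕ} {p β : ℝ} (hp0 : 0 ≤ p) (hp1 : p ≤ 1 / 2)
    (hβ : 0 ≤ β) (hk : k ≤ m) (C : Codebook n m) (φ : Decoder n m k)
    (h : ∀ T : Finset (Fin m), T.card = k + 1 →
      k + 1 ≤ 2 * (T.filter fun s => β ≤ confusionProb p C T s).card) :
    ((m - k : ℕ) : ℝ) * β / (4 * (1 + ((m - k : ℕ) : ℝ) * β)) ≤ errorProb C p k φ := by
  classical
  have hkk : m - (m - k) + 1 = k + 1 := by omega
  set r := m - k with hr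
  have hN : (0 : ℝ) < Fintype.card (Fin r ↪ Fin m) := by exact_mod_cast card_embedding_pos m k
  set N : ℝ := (Fintype.card (Fin r ↪ Fin m) : ℝ) with hNdef
  have hD : (0 : ℝ) < 1 + r * β := by positivity
  have h1 : (r : ℝ) * (N * β / 2) ≤ ∑ σ : Fin r ↪ Fin m, ∑ i,
      if β ≤ confusionProb p C (candidates σ i) (σ i) then β else 0 := by
    rw [Finset.sum_comm]
    refine le_trans (by simp) (Finset.card_nsmul_le_sum (Finset.univ : Finset (Fin r)) _
      (N * β / 2) fun i _ => ?_)
    rw [← Finset.sum_filter, Finset.sum_const, nsmul_eq_mul]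
    have h2 := card_embedding_le_two_mul_card_filter i
      (fun T s => β ≤ confusionProb p C T s) (by rw [hkk]; exact h)
    have h3 : N ≤ 2 * ((Finset.univ.filter fun σ : Fin r ↪ Fin m =>
        β ≤ confusionProb p C (candidates σ i) (σ i)).card : ℝ) := by
      rw [hNdef]
      exact_mod_cast h2
    nlinarith
  have h4 : (∑ σ : Fin r ↪ Fin m, ∑ i,
      if β ≤ confusionProb p C (candidates σ i) (σ i) then β else 0) / (1 + r * β)
      ≤ 2 * ∑ σ : Fin r ↪ Fin m, condErrorProb C p φ σ := by
    rw [Finset.sum_div]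
    exact (Finset.sum_le_sum fun σ _ => le_sum_ambiguous hp0 (by linarith) hβ C σ).trans
      (sum_ambiguous_le hp0 hp1 C φ)
  rw [div_le_iff₀ hD] at h4
  rw [errorProb, le_div_iff₀ hN, div_mul_eq_mul_div, div_le_iff₀ (by positivity)]
  nlinarith

/-! ### Close pairs of codewords and Plotkin's bound -/

theorem hammingDist_eq_sum {n : ℕ} (x y : Fin n → Bool) :
    hammingDist x y = ∑ i, if x i ≠ y i then 1 else 0 := by
  rw [hammingDist, Finset.card_filter]

/-- Two codewords at distance `d` are confused at least when the channel flips exactly `⌈d / 2⌉` of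
the positions where they differ; the remaining positions are unconstrained. -/
theorem choose_mul_le_confusionProb {n m : ℕ} {p : ℝ} (hp0 : 0 ≤ p) (hp1 : p ≤ 1)
    (C : Codebook n m) {T : Finset (Fin m)} {s t : Fin m} (ht : t ∈ T) (hts : t ≠ s) {d : ℕ}
    (hd : hammingDist (C s) (C t) = d) :
    (d.choose (d / 2) : ℝ) * (p ^ (d - d / 2) * (1 - p) ^ (d / 2)) ≤ confusionProb p C T s := by
  classical
  set x := C s with hx
  set x' := C t with hx'
  set F : Finset (Fin n) := Finset.univ.filter fun i => x i ≠ x' i with hF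
  have hFd : F.card = d := hd
  -- The words that differ from `x`, among the positions in `F`, exactly at those in `A`.
  set cyl : Finset (Fin n) → Finset (Fin n → Bool) := fun A => Fintype.piFinset fun i =>
    if i ∈ F then {if i ∈ A then !x i else x i} else Finset.univ with hcyl
  have hmem : ∀ {A y}, y ∈ cyl A → ∀ i ∈ F, (y i ≠ x i ↔ i ∈ A) := by
    intro A y hy i hi
    have h := (Fintype.mem_piFinset.1 hy) i
    rw [if_pos hi, Finset.mem_singleton] at h
    rw [h]
    by_cases hA : i ∈ A <;> simp [hA]
  have hmass : ∀ A ∈ F.powersetCard (d - d / 2),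
      ∑ y ∈ cyl A, bscProb p x y = p ^ (d - d / 2) * (1 - p) ^ (d / 2) := by
    intro A hA
    obtain ⟨hAF, hAc⟩ := Finset.mem_powersetCard.1 hA
    rw [hcyl, sum_bscProb_piFinset]
    have h1 : ∀ i, (∑ b ∈ (if i ∈ F then {if i ∈ A then !x i else x i} else Finset.univ :
        Finset Bool), if b ≠ x i then p else 1 - p)
        = if i ∈ A then p else if i ∈ F then 1 - p else 1 := by
      intro i
      by_cases hi : i ∈ F
      · by_cases hi' : i ∈ A <;> simp [hi, hi']
      · have hi' : i ∉ A := fun h => hi (hAF h)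
        simp only [hi, hi', if_false]
        cases x i <;> simp
    rw [Finset.prod_congr rfl fun i _ => h1 i, Finset.prod_ite, Finset.prod_const,
      ← Finset.prod_filter, Finset.prod_const]
    have h2 : (Finset.univ.filter fun i => i ∈ A) = A := by simp
    have h3 : ((Finset.univ.filter fun i => i ∉ A).filter fun i => i ∈ F) = F \ A := by
      ext i
      simp [and_comm]
    rw [h2, h3, Finset.card_sdiff_of_subset hAF, hAc, hFd]
    congr 2
    omega
  have hdisj : (F.powersetCard (d - d / 2) : Set (Finset (Fin n))).PairwiseDisjoint cyl := by
    intro A hA A' hA' hne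
    refine Finset.disjoint_left.2 fun y hy hy' => hne ?_
    have hAF := (Finset.mem_powersetCard.1 (Finset.mem_coe.1 hA)).1
    have hAF' := (Finset.mem_powersetCard.1 (Finset.mem_coe.1 hA')).1
    ext i
    constructor
    · exact fun h => (hmem hy' i (hAF h)).1 ((hmem hy i (hAF h)).2 h)
    · exact fun h => (hmem hy i (hAF' h)).1 ((hmem hy' i (hAF' h)).2 h)
  have hsub : (F.powersetCard (d - d / 2)).biUnion cyl ⊆ confusable C T s := by
    intro y hy
    obtain ⟨A, hA, hyA⟩ := Finset.mem_biUnion.1 hy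
    obtain ⟨hAF, hAc⟩ := Finset.mem_powersetCard.1 hA
    refine mem_confusable.2 ⟨t, ht, hts, ?_⟩
    rw [← hx, ← hx', hammingDist_eq_sum, hammingDist_eq_sum, ← Finset.sum_add_sum_compl F,
      ← Finset.sum_add_sum_compl F (fun i => if y i ≠ x i then 1 else 0)]
    refine add_le_add ?_ (Finset.sum_le_sum fun i hi => ?_)
    · have h1 : ∑ i ∈ F, (if y i ≠ x i then 1 else 0) = A.card := by
        rw [← Finset.card_filter]
        congr 1
        ext i
        rw [Finset.mem_filter]
        exact ⟨fun h => (hmem hyA i h.1).1 h.2, fun h => ⟨hAF h, (hmem hyA i (hAF h)).2 h⟩⟩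
      have h2 : ∑ i ∈ F, (if y i ≠ x' i then 1 else 0) = (F \ A).card := by
        rw [← Finset.card_filter]
        congr 1
        ext i
        rw [Finset.mem_filter, Finset.mem_sdiff]
        refine and_congr_right fun hi => ?_
        rw [← hmem hyA i hi]
        have hxx : x i ≠ x' i := (Finset.mem_filter.1 hi).2
        revert hxx
        cases y i <;> cases x i <;> cases x' i <;> simp
      rw [h1, h2, Finset.card_sdiff_of_subset hAF, hAc, hFd]
      omega
    · have hxx : x i = x' i := by simpa [hF] using hi
      rw [hxx]
  calc (d.choose (d / 2) : ℝ) * (p ^ (d - d / 2) * (1 - p) ^ (d / 2))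
      = ∑ A ∈ F.powersetCard (d - d / 2), ∑ y ∈ cyl A, bscProb p x y := by
        rw [Finset.sum_congr rfl hmass, Finset.sum_const, Finset.card_powersetCard, hFd,
          Nat.choose_symm (Nat.div_le_self d 2), nsmul_eq_mul]
    _ = ∑ y ∈ (F.powersetCard (d - d / 2)).biUnion cyl, bscProb p x y :=
        (Finset.sum_biUnion hdisj).symm
    _ ≤ _ := Finset.sum_le_sum_of_subset_of_nonneg hsub fun _ _ _ => bscProb_nonneg hp0 hp1 _ _

theorem two_pow_le_succ_mul_choose_half (d : ℕ) : 2 ^ d ≤ (d + 1) * d.choose (d / 2) := by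
  rw [← Nat.sum_range_choose]
  refine (Finset.sum_le_card_nsmul _ _ _ fun j _ => Nat.choose_le_middle j d).trans ?_
  simp

theorem sqrt_four_mul_eq (p : ℝ) :
    Real.sqrt (4 * p * (1 - p)) = 2 * Real.sqrt (p * (1 - p)) := by
  rw [mul_assoc, Real.sqrt_mul (by norm_num), show (4 : ℝ) = 2 ^ 2 by norm_num,
    Real.sqrt_sq (by norm_num)]

theorem sqrt_four_mul_le_one {p : ℝ} : Real.sqrt (4 * p * (1 - p)) ≤ 1 :=
  Real.sqrt_le_iff.2 ⟨zero_le_one, by nlinarith [sq_nonneg (2 * p - 1)]⟩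

/-- The factor `p` absorbs the extra flip when `d` is odd. -/
theorem le_choose_mul {p : ℝ} (hp0 : 0 ≤ p) (hp1 : p ≤ 1) (d : ℕ) :
    p * Real.sqrt (4 * p * (1 - p)) ^ d / (d + 1)
      ≤ (d.choose (d / 2) : ℝ) * (p ^ (d - d / 2) * (1 - p) ^ (d / 2)) := by
  set q := Real.sqrt (p * (1 - p)) with hq
  have hpq : 0 ≤ p * (1 - p) := mul_nonneg hp0 (by linarith)
  have hq0 : 0 ≤ q := Real.sqrt_nonneg _
  have hq1 : q ≤ 1 :=
    Real.sqrt_le_iff.2 ⟨zero_le_one, by nlinarith⟩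
  have hqq : q ^ 2 = p * (1 - p) := Real.sq_sqrt hpq
  have h1 : p * q ^ d ≤ p ^ (d - d / 2) * (1 - p) ^ (d / 2) := by
    rcases Nat.even_or_odd' d with ⟨e, rfl | rfl⟩
    · rw [show 2 * e / 2 = e by omega, show 2 * e - e = e by omega, pow_mul, hqq, mul_pow]
      exact mul_le_of_le_one_left (mul_nonneg (pow_nonneg hp0 _) (pow_nonneg (by linarith) _)) hp1
    · rw [show (2 * e + 1) / 2 = e by omega, show 2 * e + 1 - e = e + 1 by omega, pow_succ, pow_mul,
        hqq, mul_pow, pow_succ]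
      have h2 : 0 ≤ p * (p ^ e * (1 - p) ^ e) :=
        mul_nonneg hp0 (mul_nonneg (pow_nonneg hp0 _) (pow_nonneg (by linarith) _))
      nlinarith
  have h3 : (2 : ℝ) ^ d ≤ (d + 1) * d.choose (d / 2) := by
    exact_mod_cast two_pow_le_succ_mul_choose_half d
  rw [sqrt_four_mul_eq, ← hq, mul_pow, div_le_iff₀ (by positivity)]
  calc p * (2 ^ d * q ^ d) = 2 ^ d * (p * q ^ d) := by ring
    _ ≤ ((d + 1) * d.choose (d / 2)) * (p ^ (d - d / 2) * (1 - p) ^ (d / 2)) :=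
      mul_le_mul h3 h1 (mul_nonneg hp0 (pow_nonneg hq0 _)) (by positivity)
    _ = _ := by ring

/-- Plotkin's bound: the sum of all mutual distances, computed column by column. -/
theorem two_mul_sum_hammingDist_le {n m : ℕ} (C : Codebook n m) (I : Finset (Fin m)) :
    2 * ∑ s ∈ I, ∑ t ∈ I, (hammingDist (C s) (C t) : ℝ) ≤ n * (I.card : ℝ) ^ 2 := by
  set sgn : Bool → ℝ := fun b => if b then 1 else -1 with hsgn
  have h1 : ∀ s t, (hammingDist (C s) (C t) : ℝ)
      = ∑ i, (1 - sgn (C s i) * sgn (C t i)) / 2 := by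
    intro s t
    rw [hammingDist_eq_sum]
    push_cast
    refine Finset.sum_congr rfl fun i _ => ?_
    cases C s i <;> cases C t i <;> norm_num [hsgn]
  have h2 : ∀ s ∈ I, ∑ t ∈ I, (hammingDist (C s) (C t) : ℝ)
      = ∑ i, ∑ t ∈ I, (1 - sgn (C s i) * sgn (C t i)) / 2 := fun s _ => by
    rw [Finset.sum_comm]
    exact Finset.sum_congr rfl fun t _ => h1 s t
  rw [Finset.sum_congr rfl h2, Finset.sum_comm, Finset.mul_sum]
  have h3 : ∀ i ∈ (Finset.univ : Finset (Fin n)),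
      2 * ∑ s ∈ I, ∑ t ∈ I, (1 - sgn (C s i) * sgn (C t i)) / 2 ≤ (I.card : ℝ) ^ 2 := by
    intro i _
    have h4 : ∑ s ∈ I, ∑ t ∈ I, (1 - sgn (C s i) * sgn (C t i)) / 2
        = ((I.card : ℝ) ^ 2 - (∑ s ∈ I, sgn (C s i)) ^ 2) / 2 := by
      simp_rw [← Finset.sum_div, Finset.sum_sub_distrib, ← Finset.mul_sum, ← Finset.sum_mul]
      simp [sq]
    rw [h4]
    nlinarith [sq_nonneg (∑ s ∈ I, sgn (C s i))]
  refine (Finset.sum_le_sum h3).trans ?_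
  simp

/-- A family of words with mutual distances at least `(1 + ε) n / 2` has at most `1 + 1 / ε`
members. -/
theorem card_mul_le_of_hammingDist {n m : ℕ} (hn : 0 < n) {ε : ℝ} (hε : 0 < ε) (C : Codebook n m)
    (I : Finset (Fin m))
    (h : ∀ s ∈ I, ∀ t ∈ I, t ≠ s → (1 + ε) * n / 2 ≤ (hammingDist (C s) (C t) : ℝ)) :
    I.card * ε ≤ 1 + ε := by
  classical
  rcases I.eq_empty_or_nonempty with rfl | hI
  · simp
    linarith
  have hM : (1 : ℝ) ≤ I.card := by exact_mod_cast hI.card_pos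
  have hn' : (0 : ℝ) < n := by exact_mod_cast hn
  have h1 : (I.card : ℝ) * ((I.card - 1) * ((1 + ε) * n / 2))
      ≤ ∑ s ∈ I, ∑ t ∈ I, (hammingDist (C s) (C t) : ℝ) := by
    rw [← nsmul_eq_mul]
    refine Finset.card_nsmul_le_sum _ _ _ fun s hs => ?_
    rw [← Finset.sum_erase_add _ _ hs]
    have h2 := Finset.card_nsmul_le_sum (I.erase s) (fun t => (hammingDist (C s) (C t) : ℝ))
      ((1 + ε) * n / 2) fun t ht =>
        h s hs t (Finset.mem_of_mem_erase ht) (Finset.ne_of_mem_erase ht)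
    rw [nsmul_eq_mul, Finset.cast_card_erase_of_mem hs] at h2
    have h3 : (0 : ℝ) ≤ (hammingDist (C s) (C s) : ℝ) := Nat.cast_nonneg _
    linarith
  have h4 := two_mul_sum_hammingDist_le C I
  have h5 : (n * I.card : ℝ) * ((I.card - 1) * (1 + ε)) ≤ (n * I.card) * I.card := by nlinarith
  have h6 := le_of_mul_le_mul_left h5 (by positivity)
  linarith

/-- In a large set of codewords, at least half have a neighbour within distance about `n / 2`. -/
theorem card_le_two_mul_card_filter_of_plotkin {n m : ℕ} (hn : 0 < n) {p ε : ℝ} (hp0 : 0 < p)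
    (hp1 : p < 1) (hε : 0 < ε) (C : Codebook n m) (T : Finset (Fin m))
    (hT : 2 * (1 + ε) ≤ T.card * ε) :
    T.card ≤ 2 * (T.filter fun s =>
      p * Real.sqrt (4 * p * (1 - p)) ^ ((1 + ε) * n / 2) / (n + 1)
        ≤ confusionProb p C T s).card := by
  set ρ := Real.sqrt (4 * p * (1 - p)) with hρ
  have hρ0 : 0 < ρ := Real.sqrt_pos.2 (mul_pos (by linarith) (by linarith))
  have hρ1 : ρ ≤ 1 := sqrt_four_mul_le_one
  set P : Fin m → Prop := fun s => p * ρ ^ ((1 + ε) * n / 2) / (n + 1) ≤ confusionProb p C T s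
    with hP
  have hI : ((T.filter fun s => ¬ P s).card : ℝ) * ε ≤ 1 + ε := by
    refine card_mul_le_of_hammingDist hn hε C _ fun s hs t ht hts => ?_
    by_contra hlt
    rw [not_le] at hlt
    refine (Finset.mem_filter.1 hs).2 ?_
    refine le_trans ?_ (choose_mul_le_confusionProb hp0.le hp1.le C
      (Finset.mem_filter.1 ht).1 hts rfl)
    refine le_trans ?_ (le_choose_mul hp0.le hp1.le _)
    rw [← hρ]
    have h1 : ρ ^ ((1 + ε) * n / 2) ≤ ρ ^ hammingDist (C s) (C t) := by
      rw [← Real.rpow_natCast]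
      exact Real.rpow_le_rpow_of_exponent_ge hρ0 hρ1 hlt.le
    have h2 : (hammingDist (C s) (C t) : ℝ) ≤ n := by exact_mod_cast hammingDist_le_length _ _
    gcongr
  have h3 := Finset.card_filter_add_card_filter_not (s := T) P
  have h4 : 2 * (T.filter fun s => ¬ P s).card ≤ T.card := by
    have h5 : (2 * ((T.filter fun s => ¬ P s).card : ℝ)) * ε ≤ T.card * ε := by linarith
    exact_mod_cast le_of_mul_le_mul_right h5 hε
  have h6 : T.card ≤ 2 * (T.filter P).card := by omega
  exact h6

/-! ### Binomial coefficients and sphere packing -/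

theorem pow_mul_factorial_le (r j : ℕ) : r ^ j * r.factorial ≤ r ^ r * j.factorial := by
  rcases le_total r j with h | h
  · obtain ⟨e, rfl⟩ := Nat.exists_eq_add_of_le h
    have h1 := Nat.factorial_mul_pow_sub_le_factorial h
    rw [Nat.add_sub_cancel_left] at h1
    calc r ^ (r + e) * r.factorial = r ^ r * (r.factorial * r ^ e) := by ring
      _ ≤ _ := Nat.mul_le_mul_left _ h1
  · have h1 := Nat.factorial_mul_descFactorial (Nat.sub_le r j)
    rw [Nat.sub_sub_self h] at h1
    have h2 := Nat.descFactorial_le_pow r (r - j)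
    calc r ^ j * r.factorial = r ^ j * (j.factorial * r.descFactorial (r - j)) := by rw [h1]
      _ ≤ r ^ j * (j.factorial * r ^ (r - j)) :=
        Nat.mul_le_mul_left _ (Nat.mul_le_mul_left _ h2)
      _ = r ^ (j + (r - j)) * j.factorial := by ring
      _ = _ := by rw [Nat.add_sub_cancel' h]

/-- In the binomial expansion of `(r + s) ^ (r + s)` the term with exponents `r` and `s` is the
largest. -/
theorem choose_mul_pow_le {r s j : ℕ} (hj : j ≤ r + s) :
    (r + s).choose j * (r ^ j * s ^ (r + s - j)) ≤ (r + s).choose r * (r ^ r * s ^ s) := by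
  have h1 := Nat.choose_mul_factorial_mul_factorial hj
  have h2 := Nat.choose_mul_factorial_mul_factorial (Nat.le_add_right r s)
  rw [Nat.add_sub_cancel_left] at h2
  refine Nat.le_of_mul_le_mul_right ?_ (Nat.mul_pos r.factorial_pos s.factorial_pos)
  calc (r + s).choose j * (r ^ j * s ^ (r + s - j)) * (r.factorial * s.factorial)
      = (r + s).choose j * ((r ^ j * r.factorial) * (s ^ (r + s - j) * s.factorial)) := by ring
    _ ≤ (r + s).choose j * ((r ^ r * j.factorial) * (s ^ s * (r + s - j).factorial)) :=
        Nat.mul_le_mul_left _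
          (Nat.mul_le_mul (pow_mul_factorial_le r j) (pow_mul_factorial_le s (r + s - j)))
    _ = ((r + s).choose j * j.factorial * (r + s - j).factorial) * (r ^ r * s ^ s) := by ring
    _ = ((r + s).choose r * r.factorial * s.factorial) * (r ^ r * s ^ s) := by rw [h1, h2]
    _ = _ := by ring

theorem pow_self_le_mul_choose (r s : ℕ) :
    (r + s) ^ (r + s) ≤ (r + s + 1) * ((r + s).choose r * (r ^ r * s ^ s)) := by
  rw [add_pow]
  refine (Finset.sum_le_card_nsmul _ _ ((r + s).choose r * (r ^ r * s ^ s)) fun j hj => ?_).trans ?_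
  · rw [mul_comm]
    exact choose_mul_pow_le (Nat.lt_succ_iff.1 (Finset.mem_range.1 hj))
  · simp

/-- A binomial coefficient is, up to a polynomial factor, the exponential of the entropy. -/
theorem exp_binEntropy_le_mul_choose {n r : ℕ} (hn : 0 < n) (hr : r ≤ n) :
    Real.exp (n * Real.binEntropy (r / n)) ≤ (n + 1) * n.choose r := by
  obtain ⟨s, rfl⟩ := Nat.exists_eq_add_of_le hr
  have hN : (0 : ℝ) < ((r + s : ℕ) : ℝ) := by exact_mod_cast hn
  have hC : (0 : ℝ) < (r + s).choose r := by exact_mod_cast Nat.choose_pos hr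
  have hpow : ∀ e : ℕ, (0 : ℝ) < (e : ℝ) ^ e := fun e => by
    exact_mod_cast Nat.pow_self_pos
  have hmul : ∀ e : ℕ, ((r + s : ℕ) : ℝ) * ((e / ((r + s : ℕ) : ℝ)) *
      Real.log (e / ((r + s : ℕ) : ℝ))⁻¹) = e * Real.log ((r + s : ℕ) : ℝ) - e * Real.log e := by
    intro e
    rcases Nat.eq_zero_or_pos e with rfl | he
    · simp
    · have he' : (0 : ℝ) < e := by exact_mod_cast he
      rw [Real.log_inv, Real.log_div he'.ne' hN.ne']
      field_simp
      ring
  have hsub : 1 - (r : ℝ) / ((r + s : ℕ) : ℝ) = s / ((r + s : ℕ) : ℝ) := by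
    rw [eq_div_iff hN.ne', sub_mul, div_mul_cancel₀ _ hN.ne']
    push_cast
    ring
  have h1 : ((r + s : ℕ) : ℝ) ^ (r + s)
      ≤ ((r + s : ℕ) + 1) * ((r + s).choose r * ((r : ℝ) ^ r * (s : ℝ) ^ s)) := by
    exact_mod_cast pow_self_le_mul_choose r s
  have h2 := Real.log_le_log (pow_pos hN _) h1
  rw [Real.log_mul (by positivity) (mul_pos hC (mul_pos (hpow r) (hpow s))).ne',
    Real.log_mul hC.ne' (mul_pos (hpow r) (hpow s)).ne',
    Real.log_mul (hpow r).ne' (hpow s).ne', Real.log_pow, Real.log_pow, Real.log_pow] at h2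
  rw [← Real.le_log_iff_exp_le (by positivity), Real.log_mul (by positivity) hC.ne',
    Real.binEntropy, mul_add, hsub, hmul, hmul]
  have h3 : ((r + s : ℕ) : ℝ) = r + s := by push_cast; ring
  have h4 : ((r + s : ℕ) : ℝ) * Real.log ((r + s : ℕ) : ℝ)
      = r * Real.log ((r + s : ℕ) : ℝ) + s * Real.log ((r + s : ℕ) : ℝ) := by
    nth_rewrite 1 [h3]
    ring
  linarith

theorem card_hammingDist_eq {n : ℕ} (x : Fin n → Bool) (l : ℕ) :
    (Finset.univ.filter fun y : Fin n → Bool => hammingDist y x = l).card = n.choose l := by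
  classical
  have h : n.choose l = ((Finset.univ : Finset (Fin n)).powersetCard l).card := by simp
  rw [h]
  refine Finset.card_bij' (fun y _ => Finset.univ.filter fun i => y i ≠ x i)
    (fun A _ i => if i ∈ A then !x i else x i) ?_ ?_ ?_ ?_
  · intro y hy
    exact Finset.mem_powersetCard.2 ⟨Finset.subset_univ _, (Finset.mem_filter.1 hy).2⟩
  · intro A hA
    refine Finset.mem_filter.2 ⟨Finset.mem_univ _, ?_⟩
    rw [← (Finset.mem_powersetCard.1 hA).2]
    unfold hammingDist
    congr 1
    ext i
    by_cases hi : i ∈ A <;> simp [hi]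
  · intro y _
    funext i
    simp only [Finset.mem_filter, Finset.mem_univ, true_and]
    cases y i <;> cases x i <;> simp
  · intro A _
    ext i
    by_cases hi : i ∈ A <;> simp [hi]

/-- Sphere packing with the spheres of radius `l`: a word of the sphere around a codeword of `T`
that is not confusable belongs to no other codeword in this way, so when the spheres together
overfill the space fourfold, at least half of them consist of confusable words to one half. -/
theorem card_le_two_mul_card_filter_of_sphere {n m l : ℕ} {p : ℝ} (hp0 : 0 < p) (hp1 : p < 1)
    (hl : l ≤ n) (C : Codebook n m) (T : Finset (Fin m))
    (hT : 4 * (2 : ℝ) ^ n ≤ T.card * n.choose l) :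
    T.card ≤ 2 * (T.filter fun s =>
      (n.choose l : ℝ) / 2 * (p ^ l * (1 - p) ^ (n - l)) ≤ confusionProb p C T s).card := by
  classical
  set w : ℝ := p ^ l * (1 - p) ^ (n - l) with hw
  have hw0 : 0 < w := mul_pos (pow_pos hp0 _) (pow_pos (by linarith) _)
  have hC : (0 : ℝ) < n.choose l := by exact_mod_cast Nat.choose_pos hl
  set P : Fin m → Prop := fun s => (n.choose l : ℝ) / 2 * w ≤ confusionProb p C T s with hP
  set sph : Fin m → Finset (Fin n → Bool) := fun s =>
    Finset.univ.filter fun y => hammingDist y (C s) = l with hsph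
  have hdisj : ((T.filter fun s => ¬ P s : Finset (Fin m)) : Set (Fin m)).PairwiseDisjoint
      fun s => sph s \ confusable C T s := by
    intro s hs t ht hst
    refine Finset.disjoint_left.2 fun y hy hy' => ?_
    have h1 := (Finset.mem_filter.1 (Finset.mem_sdiff.1 hy).1).2
    have h2 := (Finset.mem_filter.1 (Finset.mem_sdiff.1 hy').1).2
    exact (Finset.mem_sdiff.1 hy).2 (mem_confusable.2
      ⟨t, (Finset.mem_filter.1 (Finset.mem_coe.1 ht)).1, hst.symm, (h2.trans h1.symm).le⟩)
  have hgood : ∀ s ∈ T.filter fun s => ¬ P s,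
      (n.choose l : ℝ) / 2 ≤ ((sph s \ confusable C T s).card : ℝ) := by
    intro s hs
    have h1 := not_le.1 (Finset.mem_filter.1 hs).2
    have h2 : ((sph s ∩ confusable C T s).card : ℝ) * w ≤ confusionProb p C T s := by
      have h3 : ∑ y ∈ sph s ∩ confusable C T s, bscProb p (C s) y
          = ((sph s ∩ confusable C T s).card : ℝ) * w := by
        rw [← nsmul_eq_mul, ← Finset.sum_const]
        refine Finset.sum_congr rfl fun y hy => ?_
        rw [bscProb, (Finset.mem_filter.1 (Finset.mem_inter.1 hy).1).2]
      rw [← h3]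
      exact Finset.sum_le_sum_of_subset_of_nonneg Finset.inter_subset_right
        fun _ _ _ => bscProb_nonneg hp0.le hp1.le _ _
    have h4 := lt_of_mul_lt_mul_right (h2.trans_lt h1) hw0.le
    have h5 := Finset.card_sdiff_add_card_inter (sph s) (confusable C T s)
    rw [hsph, card_hammingDist_eq, ← hsph] at h5
    have h6 : ((sph s \ confusable C T s).card : ℝ) + (sph s ∩ confusable C T s).card
        = n.choose l := by exact_mod_cast h5
    linarith
  have h7 : ((T.filter fun s => ¬ P s).card : ℝ) * (n.choose l / 2) ≤ 2 ^ n := by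
    rw [← nsmul_eq_mul]
    refine (Finset.card_nsmul_le_sum _ _ _ hgood).trans ?_
    rw [← Nat.cast_sum, ← Finset.card_biUnion hdisj]
    have h8 : ((T.filter fun s => ¬ P s).biUnion fun s => sph s \ confusable C T s).card ≤ 2 ^ n :=
      (Finset.card_le_univ _).trans (by simp)
    exact_mod_cast h8
  have h9 : 2 * (T.filter fun s => ¬ P s).card ≤ T.card := by
    have h10 : (2 * ((T.filter fun s => ¬ P s).card : ℝ)) * n.choose l ≤ T.card * n.choose l := by
      linarith
    exact_mod_cast le_of_mul_le_mul_right h10 hC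
  have h11 := Finset.card_filter_add_card_filter_not (s := T) P
  have h12 : T.card ≤ 2 * (T.filter P).card := by omega
  exact h12

/-! ### Bounds on the exponent and on the number of bees -/

theorem exponent_le_of_eventually_le {R p α a : ℝ} {v : ℕ → ℝ} (hv : Tendsto v atTop (𝓝 a))
    (h : ∀ᶠ n : ℕ in atTop, -(1 / (n : ℝ)) *
      Real.logb 2 (minErrorProb n (numBees R n) p (numAbsent α (numBees R n))) ≤ v n) :
    exponent R p α ≤ (a : EReal) := by
  have h1 : Tendsto (fun n => ((v n : ℝ) : EReal)) atTop (𝓝 (a : EReal)) :=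
    (continuous_coe_real_ereal.tendsto a).comp hv
  rw [← h1.limsup_eq]
  exact limsup_le_limsup (h.mono fun n hn => EReal.coe_le_coe_iff.2 hn)

theorem le_exponent_of_eventually_le {R p α a : ℝ} {v : ℕ → ℝ} (hv : Tendsto v atTop (𝓝 a))
    (h : ∀ᶠ n : ℕ in atTop, v n ≤ -(1 / (n : ℝ)) *
      Real.logb 2 (minErrorProb n (numBees R n) p (numAbsent α (numBees R n)))) :
    (a : EReal) ≤ exponent R p α := by
  have h1 : Tendsto (fun n => ((v n : ℝ) : EReal)) atTop (𝓝 (a : EReal)) :=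
    (continuous_coe_real_ereal.tendsto a).comp hv
  rw [← h1.limsup_eq]
  exact limsup_le_limsup (h.mono fun n hn => EReal.coe_le_coe_iff.2 hn)

theorem rpow_le_numBees (R : ℝ) (n : ℕ) : (2 : ℝ) ^ ((n : ℝ) * R) ≤ numBees R n :=
  Nat.le_ceil _

theorem numBees_pos (R : ℝ) (n : ℕ) : 0 < numBees R n :=
  Nat.ceil_pos.2 (Real.rpow_pos_of_pos two_pos _)

theorem numAbsent_lt {α : ℝ} (hα0 : 0 < α) (hα1 : α < 1) {m : ℕ} (hm : 0 < m) :
    numAbsent α m < m := by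
  have hm' : (0 : ℝ) < m := by exact_mod_cast hm
  rw [numAbsent, Nat.floor_lt (by positivity)]
  nlinarith

theorem mul_le_numAbsent_add_one (α : ℝ) (m : ℕ) : α * m ≤ (numAbsent α m : ℝ) + 1 :=
  (Nat.lt_floor_add_one _).le

theorem mul_le_sub_numAbsent {α : ℝ} (hα0 : 0 < α) (hα1 : α < 1) {m : ℕ} (hm : 0 < m) :
    (1 - α) * m ≤ ((m - numAbsent α m : ℕ) : ℝ) := by
  rw [Nat.cast_sub (numAbsent_lt hα0 hα1 hm).le]
  have h : (numAbsent α m : ℝ) ≤ α * m := Nat.floor_le (by positivity)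
  linarith

/-! ### Rates from the critical rate on -/

theorem entropyBits_eq (x : ℝ) : entropyBits x = Real.binEntropy x / Real.log 2 := by
  simp only [entropyBits, Real.binEntropy, Real.logb, Real.log_inv]
  ring

/-- The inequality `2 h(x) + log (x ^ 2 + (1 - x) ^ 2) < log 2`, with `x = 1 / (1 + t)`, between
Shannon and collision entropy. -/
theorem log_one_add_sq_sub_lt {t : ℝ} (ht : 1 < t) :
    Real.log (1 + t ^ 2) - 2 * t * Real.log t / (1 + t) < Real.log 2 := by
  set f : ℝ → ℝ := fun t => Real.log (1 + t ^ 2) - 2 * t * Real.log t / (1 + t) with hf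
  have hderiv : ∀ x : ℝ, 0 < x → HasDerivAt f
      (2 * x / (1 + x ^ 2) - ((2 * Real.log x + 2) * (1 + x) - 2 * x * Real.log x) / (1 + x) ^ 2)
      x := by
    intro x hx
    have h1 : HasDerivAt (fun t : ℝ => Real.log (1 + t ^ 2)) (2 * x / (1 + x ^ 2)) x := by
      have := ((hasDerivAt_pow 2 x).const_add 1).log (by positivity)
      simpa using this
    have h2 : HasDerivAt (fun t : ℝ => 2 * t * Real.log t) (2 * Real.log x + 2) x := by
      have h3 := ((hasDerivAt_id x).const_mul 2).mul (Real.hasDerivAt_log hx.ne')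
      refine h3.congr_deriv ?_
      simp only [id]
      field_simp
    have h4 : HasDerivAt (fun t : ℝ => 1 + t) 1 x := (hasDerivAt_id x).const_add 1
    have h5 := h1.sub (h2.div h4 (by positivity))
    refine h5.congr_deriv ?_
    ring
  have hanti : StrictAntiOn f (Set.Ici 1) := by
    refine strictAntiOn_of_deriv_neg (convex_Ici 1)
      (fun x hx => (hderiv x (lt_of_lt_of_le one_pos hx)).continuousAt.continuousWithinAt)
      fun x hx => ?_
    rw [interior_Ici, Set.mem_Ioi] at hx
    have hx0 : 0 < x := by linarith
    rw [(hderiv x hx0).deriv]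
    -- `log s > 2 (s - 1) / (s + 1)` at `s = x ^ 2`.
    have h1 := Real.lt_log_one_add_of_pos (x := x ^ 2 - 1) (by nlinarith)
    rw [show 1 + (x ^ 2 - 1) = x ^ 2 by ring, show x ^ 2 - 1 + 2 = 1 + x ^ 2 by ring,
      Real.log_pow, div_lt_iff₀ (by positivity)] at h1
    push_cast at h1
    rw [sub_neg, div_lt_div_iff₀ (by positivity) (by positivity)]
    nlinarith
  have h := hanti (Set.mem_Ici.2 le_rfl) (Set.mem_Ici.2 ht.le) ht
  simpa [hf, one_add_one_eq_two] using h

/-- The tilted crossover probability `δ` for which the critical rate is `1 - H(δ)`. -/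
noncomputable def criticalCrossover (p : ℝ) : ℝ := Real.sqrt p / (Real.sqrt p + Real.sqrt (1 - p))

theorem criticalCrossover_pos {p : ℝ} (hp0 : 0 < p) : 0 < criticalCrossover p :=
  div_pos (Real.sqrt_pos.2 hp0)
    (add_pos_of_pos_of_nonneg (Real.sqrt_pos.2 hp0) (Real.sqrt_nonneg _))

theorem criticalCrossover_lt {p : ℝ} (hp0 : 0 < p) (hp1 : p < 1 / 2) :
    criticalCrossover p < 2⁻¹ := by
  have h1 := Real.sqrt_pos.2 hp0
  have h2 : Real.sqrt p < Real.sqrt (1 - p) := Real.sqrt_lt_sqrt hp0.le (by linarith)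
  rw [criticalCrossover, div_lt_iff₀ (by linarith)]
  linarith

/-- At the critical crossover `δ`, a word at distance `δ n` has likelihood above `2 ^ (-n)`;
equivalently the sphere-packing exponent at the critical rate is below that rate. -/
theorem neg_log_criticalCrossover_lt {p : ℝ} (hp0 : 0 < p) (hp1 : p < 1 / 2) :
    -(criticalCrossover p * Real.log p) - (1 - criticalCrossover p) * Real.log (1 - p)
      < Real.log 2 := by
  set a := Real.sqrt p with ha
  set b := Real.sqrt (1 - p) with hb
  have ha0 : 0 < a := Real.sqrt_pos.2 hp0
  have hab : a < b := Real.sqrt_lt_sqrt hp0.le (by linarith)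
  have hb0 : 0 < b := ha0.trans hab
  have ha2 : a ^ 2 = p := Real.sq_sqrt hp0.le
  have hb2 : b ^ 2 = 1 - p := Real.sq_sqrt (by linarith)
  have h := log_one_add_sq_sub_lt ((one_lt_div ha0).2 hab)
  have h1 : 1 + (b / a) ^ 2 = (a ^ 2)⁻¹ := by
    have h2 : a ^ 2 + b ^ 2 = 1 := by linarith
    field_simp
    linarith
  rw [h1, Real.log_inv, Real.log_pow, Real.log_div hb0.ne' ha0.ne'] at h
  rw [criticalCrossover, ← ha, ← hb, ← hb2]
  nth_rewrite 1 [← ha2]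
  rw [Real.log_pow, Real.log_pow]
  refine lt_of_eq_of_lt ?_ h
  have h3 : 0 < a + b := by linarith
  have h4 : (1 : ℝ) + b / a ≠ 0 := by positivity
  push_cast
  field_simp
  ring

/-- Above the critical rate there is a radius `x n` at which the spheres around the codewords
overfill the space although the channel reaches a given word of them with probability at least
`2 ^ (-n)`. -/
theorem exists_radius {p R : ℝ} (hp0 : 0 < p) (hp1 : p < 1 / 2) (hR : criticalRate p ≤ R) :
    ∃ x : ℝ, 0 < x ∧ x < 1 ∧ Real.log 2 < R * Real.log 2 + Real.binEntropy x ∧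
      -(x * Real.log p) - (1 - x) * Real.log (1 - p) ≤ Real.log 2 := by
  have hcont : Continuous fun x : ℝ => -(x * Real.log p) - (1 - x) * Real.log (1 - p) := by
    fun_prop
  have h1 : ∀ᶠ x in 𝓝[>] (criticalCrossover p),
      -(x * Real.log p) - (1 - x) * Real.log (1 - p) < Real.log 2 :=
    (hcont.tendsto _).mono_left nhdsWithin_le_nhds
      |>.eventually_lt_const (neg_log_criticalCrossover_lt hp0 hp1)
  have h2 := Ioo_mem_nhdsGT (criticalCrossover_lt hp0 hp1)
  obtain ⟨x, hx1, hx2⟩ := (h1.and h2).exists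
  have hδ := criticalCrossover_pos hp0
  refine ⟨x, hδ.trans hx2.1, hx2.2.trans (by norm_num), ?_, hx1.le⟩
  have h3 := Real.binEntropy_strictMonoOn ⟨hδ.le, (criticalCrossover_lt hp0 hp1).le⟩
    ⟨(hδ.trans hx2.1).le, hx2.2.le⟩ hx2.1
  have hlog : 0 < Real.log 2 := Real.log_pos one_lt_two
  rw [criticalRate, ← criticalCrossover, entropyBits_eq] at hR
  have h4 : Real.log 2 - Real.binEntropy (criticalCrossover p) ≤ R * Real.log 2 := by
    have h5 := mul_le_mul_of_nonneg_right hR hlog.le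
    rwa [sub_mul, div_mul_cancel₀ _ hlog.ne', one_mul] at h5
  linarith

theorem eventually_mul_succ_le_exp {γ : ℝ} (hγ : 0 < γ) (c : ℝ) :
    ∀ᶠ n : ℕ in atTop, c * ((n : ℝ) + 1) ≤ Real.exp (γ * n) := by
  have hr : 1 < Real.exp γ := Real.one_lt_exp_iff.2 hγ
  have h1 := ((tendsto_pow_const_div_const_pow_of_one_lt 1 hr).add
    (tendsto_pow_const_div_const_pow_of_one_lt 0 hr)).const_mul c
  rw [add_zero, mul_zero] at h1
  filter_upwards [h1.eventually_lt_const one_pos] with n hn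
  have h2 : Real.exp (γ * n) = Real.exp γ ^ n := by rw [mul_comm, Real.exp_nat_mul]
  rw [pow_one, pow_zero, ← add_div, ← mul_div_assoc, div_lt_one (by positivity)] at hn
  rw [h2]
  exact hn.le

theorem floor_mul_le {x : ℝ} (hx1 : x ≤ 1) (n : ℕ) : ⌊x * n⌋₊ ≤ n :=
  Nat.floor_le_of_le (mul_le_of_le_one_left (Nat.cast_nonneg n) hx1)

/-- If `R + H(x) > 1`, then `2 ^ (n R)` spheres of radius `x n` overfill the space by any given
factor. -/
theorem eventually_mul_two_pow_le {R x : ℝ} (hx0 : 0 < x) (hx1 : x < 1)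
    (h : Real.log 2 < R * Real.log 2 + Real.binEntropy x) (c : ℝ) :
    ∀ᶠ n : ℕ in atTop, c * (2 : ℝ) ^ n ≤ (2 : ℝ) ^ ((n : ℝ) * R) * n.choose ⌊x * n⌋₊ := by
  have hfl : Tendsto (fun n : ℕ => (⌊x * (n : ℝ)⌋₊ : ℝ) / n) atTop (𝓝 x) :=
    (tendsto_nat_floor_mul_div_atTop hx0.le).comp tendsto_natCast_atTop_atTop
  have hH := (Real.binEntropy_continuous.tendsto x).comp hfl
  set γ := (R * Real.log 2 + Real.binEntropy x - Real.log 2) / 2 with hγ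
  have hγ0 : 0 < γ := by linarith
  have h1 := hH.eventually_const_lt (show Real.binEntropy x - γ < Real.binEntropy x by linarith)
  filter_upwards [h1, eventually_mul_succ_le_exp hγ0 c, eventually_gt_atTop 0] with n hn1 hn2 hn
  have hn' : (0 : ℝ) < n := by exact_mod_cast hn
  have hle := floor_mul_le hx1.le n
  have h2 := exp_binEntropy_le_mul_choose hn hle
  have h3 : Real.exp (n * (Real.binEntropy x - γ)) ≤ (n + 1) * n.choose ⌊x * (n : ℝ)⌋₊ :=
    (Real.exp_le_exp.2 (mul_le_mul_of_nonneg_left hn1.le hn'.le)).trans h2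
  have h4 : (2 : ℝ) ^ ((n : ℝ) * R) = Real.exp (n * R * Real.log 2) := by
    rw [Real.rpow_def_of_pos two_pos]
    ring_nf
  have h5 : (2 : ℝ) ^ n = Real.exp (n * Real.log 2) := by
    rw [Real.exp_nat_mul, Real.exp_log two_pos]
  have h6 : Real.exp (γ * n) * Real.exp (n * Real.log 2)
      = Real.exp (n * R * Real.log 2) * Real.exp (n * (Real.binEntropy x - γ)) := by
    rw [← Real.exp_add, ← Real.exp_add, hγ]
    ring_nf
  have hn1' : (0 : ℝ) < n + 1 := by positivity
  refine le_of_mul_le_mul_right ?_ hn1'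
  rw [h4, h5]
  calc c * Real.exp (n * Real.log 2) * (n + 1) = c * (n + 1) * Real.exp (n * Real.log 2) := by ring
    _ ≤ Real.exp (γ * n) * Real.exp (n * Real.log 2) := by gcongr
    _ = Real.exp (n * R * Real.log 2) * Real.exp (n * (Real.binEntropy x - γ)) := h6
    _ ≤ Real.exp (n * R * Real.log 2) * ((n + 1) * n.choose ⌊x * (n : ℝ)⌋₊) := by gcongr
    _ = _ := by ring

theorem two_pow_neg_le {p x : ℝ} (hp0 : 0 < p) (hp1 : p < 1 / 2) (hx0 : 0 ≤ x) (hx1 : x ≤ 1)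
    (h : -(x * Real.log p) - (1 - x) * Real.log (1 - p) ≤ Real.log 2) (n : ℕ) :
    1 ≤ p ^ ⌊x * n⌋₊ * (1 - p) ^ (n - ⌊x * n⌋₊) * (2 : ℝ) ^ n := by
  have hfl : (⌊x * (n : ℝ)⌋₊ : ℝ) ≤ x * n := Nat.floor_le (by positivity)
  have hle := floor_mul_le hx1 n
  generalize ⌊x * (n : ℝ)⌋₊ = l at *
  have hq : 0 < 1 - p := by linarith
  have hpos : 0 < p ^ l * (1 - p) ^ (n - l) := by positivity
  rw [← Real.log_nonneg_iff (by positivity), Real.log_mul hpos.ne' (by positivity),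
    Real.log_mul (by positivity) (by positivity), Real.log_pow, Real.log_pow, Real.log_pow,
    Nat.cast_sub hle]
  have h1 : Real.log p < Real.log (1 - p) := Real.log_lt_log hp0 (by linarith)
  have h2 := mul_le_mul_of_nonneg_left h (Nat.cast_nonneg n : (0 : ℝ) ≤ n)
  nlinarith

/-- Above the critical rate, confusion in some row is so likely that the identification error does
not tend to `0`. -/
theorem inv_eight_le_minErrorProb {R p α : ℝ} (hp0 : 0 < p) (hp1 : p < 1 / 2) (hα0 : 0 < α)
    (hα1 : α < 1) (hR : criticalRate p ≤ R) :
    ∀ᶠ n : ℕ in atTop, 1 / 8 ≤ minErrorProb n (numBees R n) p (numAbsent α (numBees R n)) := by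
  obtain ⟨x, hx0, hx1, hx2, hx3⟩ := exists_radius hp0 hp1 hR
  filter_upwards [eventually_mul_two_pow_le hx0 hx1 hx2 (4 / α),
    eventually_mul_two_pow_le hx0 hx1 hx2 (2 / (1 - α))] with n h1 h2
  have hle := floor_mul_le hx1.le n
  have hw := two_pow_neg_le hp0 hp1 hx0.le hx1.le hx3 n
  set l := ⌊x * (n : ℝ)⌋₊ with hl
  set m := numBees R n with hm
  set k := numAbsent α m with hk
  have hm0 : 0 < m := numBees_pos R n
  have hmR : (2 : ℝ) ^ ((n : ℝ) * R) ≤ m := rpow_le_numBees R n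
  have hC : (0 : ℝ) < n.choose l := by exact_mod_cast Nat.choose_pos hle
  have hα1' : 0 < 1 - α := by linarith
  have hk1 : α * m ≤ (k : ℝ) + 1 := mul_le_numAbsent_add_one α m
  have hr : (1 - α) * m ≤ ((m - k : ℕ) : ℝ) := mul_le_sub_numAbsent hα0 hα1 hm0
  set w : ℝ := p ^ l * (1 - p) ^ (n - l) with hwdef
  have hw0 : 0 < w := mul_pos (pow_pos hp0 _) (pow_pos (by linarith) _)
  have hT : 4 * (2 : ℝ) ^ n ≤ ((k + 1 : ℕ) : ℝ) * n.choose l := by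
    have h3 : 4 / α * (2 : ℝ) ^ n ≤ m * n.choose l := h1.trans (by gcongr)
    rw [div_mul_eq_mul_div, div_le_iff₀ hα0] at h3
    push_cast
    nlinarith
  have hrβ : 1 ≤ ((m - k : ℕ) : ℝ) * ((n.choose l : ℝ) / 2 * w) := by
    have h3 : 2 / (1 - α) * (2 : ℝ) ^ n ≤ m * n.choose l := h2.trans (by gcongr)
    rw [div_mul_eq_mul_div, div_le_iff₀ hα1'] at h3
    have h4 : (2 : ℝ) ^ n ≤ ((m - k : ℕ) : ℝ) * ((n.choose l : ℝ) / 2) := by nlinarith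
    calc (1 : ℝ) ≤ w * 2 ^ n := hw
      _ ≤ w * (((m - k : ℕ) : ℝ) * ((n.choose l : ℝ) / 2)) := by gcongr
      _ = _ := by ring
  refine le_minErrorProb fun C φ => le_trans ?_ (le_errorProb_of_confusionProb
    (β := (n.choose l : ℝ) / 2 * w) hp0.le hp1.le (by positivity)
    (numAbsent_lt hα0 hα1 hm0).le C φ fun T hTc => ?_)
  · rw [div_le_div_iff₀ (by norm_num) (by linarith)]
    linarith
  · rw [← hTc]
    exact card_le_two_mul_card_filter_of_sphere hp0 (by linarith) hle C T (by rw [hTc]; exact hT)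

theorem zero_le_exponent {R p α : ℝ} (hp0 : 0 < p) (hp1 : p < 1) : 0 ≤ exponent R p α := by
  refine le_exponent_of_eventually_le (v := fun _ => 0) (a := 0) tendsto_const_nhds
    (Eventually.of_forall fun n => ?_)
  have h0 : 0 ≤ minErrorProb n (numBees R n) p (numAbsent α (numBees R n)) :=
    le_minErrorProb fun C φ => errorProb_nonneg C hp0.le hp1.le φ
  have h1 := Real.logb_nonpos one_lt_two h0 (minErrorProb_le_one hp0.le hp1.le)
  have h2 : (0 : ℝ) ≤ 1 / n := by positivity
  nlinarith

theorem tendsto_const_div_natCast (c : ℝ) : Tendsto (fun n : ℕ => c / (n : ℝ)) atTop (𝓝 0) :=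
  tendsto_const_nhds.div_atTop tendsto_natCast_atTop_atTop

theorem exponent_eq_zero_of_criticalRate_le {R p α : ℝ} (hp0 : 0 < p) (hp1 : p < 1 / 2)
    (hα0 : 0 < α) (hα1 : α < 1) (hR : criticalRate p ≤ R) : exponent R p α = 0 := by
  refine le_antisymm ?_ (zero_le_exponent hp0 (by linarith))
  refine exponent_le_of_eventually_le (a := 0) (tendsto_const_div_natCast 3) ?_
  filter_upwards [inv_eight_le_minErrorProb hp0 hp1 hα0 hα1 hR] with n hn
  have h1 := Real.logb_le_logb_of_le one_lt_two (by norm_num) hn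
  rw [show (1 / 8 : ℝ) = (2 : ℝ) ^ (-3 : ℝ) by
    rw [Real.rpow_neg two_pos.le]; norm_num, Real.logb_rpow two_pos (by norm_num)] at h1
  have h2 : (0 : ℝ) ≤ 1 / n := by positivity
  calc _ = 1 / (n : ℝ) * (-Real.logb 2 _) := by ring
    _ ≤ 1 / (n : ℝ) * 3 := mul_le_mul_of_nonneg_left (by linarith) h2
    _ = _ := by ring

/-! ### The upper bound at positive rates -/

theorem tendsto_two_rpow_mul_atTop {R : ℝ} (hR : 0 < R) :
    Tendsto (fun n : ℕ => (2 : ℝ) ^ ((n : ℝ) * R)) atTop atTop := by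
  have h : ∀ n : ℕ, (2 : ℝ) ^ ((n : ℝ) * R) = ((2 : ℝ) ^ R) ^ n := fun n => by
    rw [mul_comm, Real.rpow_mul two_pos.le, Real.rpow_natCast]
  simp_rw [h]
  exact tendsto_pow_atTop_atTop_of_one_lt (Real.one_lt_rpow one_lt_two hR)

theorem sqrt_four_mul_pos {p : ℝ} (hp0 : 0 < p) (hp1 : p < 1) :
    0 < Real.sqrt (4 * p * (1 - p)) :=
  Real.sqrt_pos.2 (mul_pos (by linarith) (by linarith))

/-- The pairs of codewords at distance at most `(1 + ε) n / 2` that every large set contains keep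
the identification error from decaying faster than the Bhattacharyya coefficient allows. The number
of bees enters only through the absentees being eventually numerous. -/
theorem eventually_le_minErrorProb {R p α ε : ℝ} (hR : 0 < R) (hp0 : 0 < p) (hp1 : p < 1 / 2)
    (hα0 : 0 < α) (hα1 : α < 1) (hε : 0 < ε) :
    ∀ᶠ n : ℕ in atTop, p * Real.sqrt (4 * p * (1 - p)) ^ ((1 + ε) * n / 2) / (n + 1) / 8
      ≤ minErrorProb n (numBees R n) p (numAbsent α (numBees R n)) := by
  filter_upwards [eventually_gt_atTop 0,
    (tendsto_two_rpow_mul_atTop hR).eventually_ge_atTop (2 * (1 + ε) / ε / α)] with n hn hn2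
  set m := numBees R n with hm
  set k := numAbsent α m with hk
  set ρ := Real.sqrt (4 * p * (1 - p)) with hρ
  have hρ0 : 0 < ρ := sqrt_four_mul_pos hp0 (by linarith)
  set β := p * ρ ^ ((1 + ε) * n / 2) / (n + 1) with hβ
  have hβ0 : 0 < β := by positivity
  have hβ1 : β ≤ 1 := by
    have h1 : ρ ^ ((1 + ε) * n / 2) ≤ 1 :=
      Real.rpow_le_one hρ0.le sqrt_four_mul_le_one (by positivity)
    have h2 : (0 : ℝ) ≤ n := Nat.cast_nonneg n
    rw [hβ, div_le_one (by positivity)]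
    nlinarith [Real.rpow_pos_of_pos hρ0 ((1 + ε) * n / 2)]
  have hm0 : 0 < m := numBees_pos R n
  have hkm : k < m := numAbsent_lt hα0 hα1 hm0
  have hr : (1 : ℝ) ≤ ((m - k : ℕ) : ℝ) := by exact_mod_cast Nat.sub_pos_of_lt hkm
  have hk1 : α * m ≤ (k : ℝ) + 1 := mul_le_numAbsent_add_one α m
  have hmR : (2 : ℝ) ^ ((n : ℝ) * R) ≤ m := rpow_le_numBees R n
  have hT : 2 * (1 + ε) ≤ ((k + 1 : ℕ) : ℝ) * ε := by
    have h1 := hn2.trans hmR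
    rw [div_le_iff₀ hα0, div_le_iff₀ hε] at h1
    push_cast
    nlinarith
  refine le_minErrorProb fun C φ => le_trans ?_ (le_errorProb_of_confusionProb
    (β := β) hp0.le hp1.le hβ0.le hkm.le C φ fun T hTc => ?_)
  · rw [div_le_div_iff₀ (by norm_num) (by positivity)]
    nlinarith [mul_nonneg (sub_nonneg.2 hr) hβ0.le,
      mul_nonneg (mul_nonneg (sub_nonneg.2 hβ1) hβ0.le) (zero_le_one.trans hr)]
  · rw [← hTc]
    exact card_le_two_mul_card_filter_of_plotkin hn hp0 (by linarith) hε C T (by rw [hTc]; exact hT)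

theorem tendsto_logb_succ_div :
    Tendsto (fun n : ℕ => Real.logb 2 ((n : ℝ) + 1) / n) atTop (𝓝 0) := by
  have h1 := (Real.tendsto_pow_log_div_mul_add_atTop 1 (-1) 1 one_ne_zero).comp
    (tendsto_atTop_add_const_right _ (1 : ℝ) (tendsto_natCast_atTop_atTop (R := ℝ)))
  have h2 := h1.div_const (Real.log 2)
  rw [zero_div] at h2
  refine h2.congr fun n => ?_
  simp only [Function.comp, pow_one, one_mul, Real.logb]
  rw [add_neg_cancel_right, div_right_comm]

theorem exponent_le_mul_bhattacharyya {R p α ε : ℝ} (hR : 0 < R) (hp0 : 0 < p) (hp1 : p < 1 / 2)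
    (hα0 : 0 < α) (hα1 : α < 1) (hε : 0 < ε) :
    exponent R p α ≤ (((1 + ε) / 2 * bhattacharyya p : ℝ) : EReal) := by
  have hlim : Tendsto (fun n : ℕ => (3 - Real.logb 2 p) / (n : ℝ) + Real.logb 2 ((n : ℝ) + 1) / n
      + (1 + ε) / 2 * bhattacharyya p) atTop (𝓝 ((1 + ε) / 2 * bhattacharyya p)) := by
    have h := ((tendsto_const_div_natCast (3 - Real.logb 2 p)).add tendsto_logb_succ_div).add_const
      ((1 + ε) / 2 * bhattacharyya p)
    rwa [add_zero, zero_add] at h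
  refine exponent_le_of_eventually_le hlim ?_
  filter_upwards [eventually_gt_atTop 0,
    eventually_le_minErrorProb hR hp0 hp1 hα0 hα1 hε] with n hn hn2
  have hn' : (0 : ℝ) < n := by exact_mod_cast hn
  have hρ0 := sqrt_four_mul_pos hp0 (show p < 1 by linarith)
  have hpow := Real.rpow_pos_of_pos hρ0 ((1 + ε) * n / 2)
  have h1 := Real.logb_le_logb_of_le one_lt_two (by positivity) hn2
  rw [Real.logb_div (by positivity) (by norm_num), Real.logb_div (by positivity) (by positivity),
    Real.logb_mul hp0.ne' hpow.ne', Real.logb_rpow_eq_mul_logb_of_pos hρ0,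
    show Real.logb 2 8 = 3 by
      rw [show (8 : ℝ) = 2 ^ (3 : ℝ) by norm_num, Real.logb_rpow two_pos (by norm_num)]] at h1
  have h2 : Real.logb 2 (Real.sqrt (4 * p * (1 - p))) = -bhattacharyya p := by
    rw [bhattacharyya, neg_neg]
  rw [h2] at h1
  have h3 : (3 - Real.logb 2 p) / (n : ℝ) + Real.logb 2 ((n : ℝ) + 1) / n
      + (1 + ε) / 2 * bhattacharyya p = 1 / (n : ℝ) * (3 - Real.logb 2 p + Real.logb 2 ((n : ℝ) + 1)
        + (1 + ε) * n / 2 * bhattacharyya p) := by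
    field_simp
  rw [h3, neg_mul, ← mul_neg]
  refine mul_le_mul_of_nonneg_left ?_ (by positivity)
  linarith

theorem exponent_le_half_bhattacharyya {R p α : ℝ} (hR : 0 < R) (hp0 : 0 < p) (hp1 : p < 1 / 2)
    (hα0 : 0 < α) (hα1 : α < 1) : exponent R p α ≤ ((bhattacharyya p / 2 : ℝ) : EReal) := by
  have h1 : Tendsto (fun ε : ℝ => (1 + ε) / 2 * bhattacharyya p) (𝓝[>] 0)
      (𝓝 (bhattacharyya p / 2)) := by
    have h : Continuous fun ε : ℝ => (1 + ε) / 2 * bhattacharyya p := by fun_prop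
    have h2 := (h.tendsto 0).mono_left (nhdsWithin_le_nhds (s := Set.Ioi 0))
    have h3 : (1 + 0) / 2 * bhattacharyya p = bhattacharyya p / 2 := by ring
    rwa [h3] at h2
  refine ge_of_tendsto ((continuous_coe_real_ereal.tendsto _).comp h1) ?_
  filter_upwards [self_mem_nhdsWithin] with ε hε
  exact exponent_le_mul_bhattacharyya hR hp0 hp1 hα0 hα1 hε

/-! ### Separate decoding of Gilbert–Varshamov codebooks -/

/-- The Bhattacharyya coefficient of two codewords depends on their distance only. -/
theorem sum_sqrt_bscProb_mul {n : ℕ} {p : ℝ} (hp0 : 0 ≤ p) (hp1 : p ≤ 1) (x x' : Fin n → Bool) :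
    ∑ y, Real.sqrt (bscProb p x y * bscProb p x' y)
      = Real.sqrt (4 * p * (1 - p)) ^ hammingDist x x' := by
  have hb : ∀ b c : Bool, 0 ≤ (if b ≠ c then p else 1 - p) := fun b c => by
    split_ifs <;> linarith
  have h1 : ∀ y : Fin n → Bool, Real.sqrt (bscProb p x y * bscProb p x' y)
      = ∏ i, Real.sqrt ((if y i ≠ x i then p else 1 - p) * (if y i ≠ x' i then p else 1 - p)) := by
    intro y
    rw [bscProb_eq_prod, bscProb_eq_prod, ← Finset.prod_mul_distrib, Real.sqrt_eq_iff_mul_self_eq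
      (Finset.prod_nonneg fun i _ => mul_nonneg (hb _ _) (hb _ _))
      (Finset.prod_nonneg fun i _ => Real.sqrt_nonneg _), ← Finset.prod_mul_distrib]
    exact Finset.prod_congr rfl fun i _ => (Real.mul_self_sqrt (mul_nonneg (hb _ _) (hb _ _))).symm
  have hs1 : Real.sqrt (p * p) = p := Real.sqrt_mul_self hp0
  have hs2 : Real.sqrt ((1 - p) * (1 - p)) = 1 - p := Real.sqrt_mul_self (by linarith)
  have h2 : ∀ i, ∑ b : Bool, Real.sqrt ((if b ≠ x i then p else 1 - p) *
      (if b ≠ x' i then p else 1 - p)) = if x i ≠ x' i then Real.sqrt (4 * p * (1 - p)) else 1 := by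
    intro i
    rw [sqrt_four_mul_eq, two_mul]
    cases x i <;> cases x' i <;> simp [hs1, hs2, mul_comm (1 - p) p]
  simp_rw [h1]
  have h3 := Finset.prod_univ_sum (fun _ : Fin n => (Finset.univ : Finset Bool)) fun i b =>
    Real.sqrt ((if b ≠ x i then p else 1 - p) * (if b ≠ x' i then p else 1 - p))
  rw [Fintype.piFinset_univ] at h3
  rw [← h3, Finset.prod_congr rfl fun i _ => h2 i, Finset.prod_ite, Finset.prod_const,
    Finset.prod_const_one, mul_one]
  rfl

/-- The union bound in Bhattacharyya form. -/
theorem confusionProb_le {n m : ℕ} {p ρD : ℝ} (hp0 : 0 ≤ p) (hp1 : p ≤ 1 / 2) (hρD : 0 ≤ ρD)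
    (C : Codebook n m) (T : Finset (Fin m)) (s : Fin m)
    (h : ∀ t, t ≠ s → Real.sqrt (4 * p * (1 - p)) ^ hammingDist (C s) (C t) ≤ ρD) :
    confusionProb p C T s ≤ m * ρD := by
  classical
  have hnn := fun (t : Fin m) y => bscProb_nonneg hp0 (show p ≤ 1 by linarith) (C t) y
  have h1 : ∀ y ∈ confusable C T s, bscProb p (C s) y
      ≤ ∑ t ∈ Finset.univ.erase s, Real.sqrt (bscProb p (C s) y * bscProb p (C t) y) := by
    intro y hy
    obtain ⟨t, -, hts, hd⟩ := mem_confusable.1 hy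
    refine le_trans ?_ (Finset.single_le_sum (fun _ _ => Real.sqrt_nonneg _)
      (Finset.mem_erase.2 ⟨hts, Finset.mem_univ t⟩))
    refine Real.le_sqrt_of_sq_le ?_
    rw [sq]
    exact mul_le_mul_of_nonneg_left (bscProb_le_of_hammingDist_le hp0 hp1 hd) (hnn s y)
  calc confusionProb p C T s
      ≤ ∑ y ∈ confusable C T s, ∑ t ∈ Finset.univ.erase s,
          Real.sqrt (bscProb p (C s) y * bscProb p (C t) y) := Finset.sum_le_sum h1
    _ ≤ ∑ y, ∑ t ∈ Finset.univ.erase s, Real.sqrt (bscProb p (C s) y * bscProb p (C t) y) :=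
        Finset.sum_le_sum_of_subset_of_nonneg (Finset.subset_univ _)
          fun _ _ _ => Finset.sum_nonneg fun _ _ => Real.sqrt_nonneg _
    _ = ∑ t ∈ Finset.univ.erase s, Real.sqrt (4 * p * (1 - p)) ^ hammingDist (C s) (C t) := by
        rw [Finset.sum_comm]
        exact Finset.sum_congr rfl fun t _ => sum_sqrt_bscProb_mul hp0 (by linarith) _ _
    _ ≤ ∑ _t ∈ Finset.univ.erase s, ρD :=
        Finset.sum_le_sum fun t ht => h t (Finset.ne_of_mem_erase ht)
    _ ≤ ∑ _t : Fin m, ρD := Finset.sum_le_sum_of_subset_of_nonneg (Finset.erase_subset _ _)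
        fun _ _ _ => hρD
    _ = m * ρD := by simp

theorem one_sub_prod_one_sub_le_sum {r : ℕ} {q : Fin r → ℝ} (h0 : ∀ i, 0 ≤ q i)
    (h1 : ∀ i, q i ≤ 1) : 1 - ∏ i, (1 - q i) ≤ ∑ i, q i := by
  induction r with
  | zero => simp
  | succ r ih =>
    rw [Fin.prod_univ_succ, Fin.sum_univ_succ]
    have h2 := ih (fun i => h0 i.succ) fun i => h1 i.succ
    have h3 : 0 ≤ ∏ i : Fin r, (1 - q i.succ) :=
      Finset.prod_nonneg fun i _ => sub_nonneg.2 (h1 _)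
    have h4 : ∏ i : Fin r, (1 - q i.succ) ≤ 1 :=
      Finset.prod_le_one (fun i _ => sub_nonneg.2 (h1 _)) fun i _ => by linarith [h0 i.succ]
    nlinarith [h0 0]

/-- Decoding each row separately to a nearest codeword. -/
theorem minErrorProb_le_sq_mul {n m k : ℕ} {p ρD : ℝ} (hp0 : 0 ≤ p) (hp1 : p ≤ 1 / 2)
    (hρD : 0 ≤ ρD) (hm : 0 < m) (C : Codebook n m)
    (h : ∀ s t, t ≠ s → Real.sqrt (4 * p * (1 - p)) ^ hammingDist (C s) (C t) ≤ ρD) :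
    minErrorProb n m p k ≤ (m : ℝ) ^ 2 * ρD := by
  classical
  have : Nonempty (Fin m) := ⟨⟨0, hm⟩⟩
  have hp1' : p ≤ 1 := by linarith
  choose dec hdec using fun y : Fin n → Bool => Finite.exists_min fun t => hammingDist y (C t)
  refine (minErrorProb_le hp0 hp1' C fun Y i => dec (Y i)).trans
    (errorProb_le_of_forall fun σ => ?_)
  have h1 : ∏ i, (1 - confusionProb p C Finset.univ (σ i))
      ≤ ∑ Y, if (fun i => dec (Y i)) = ⇑σ then outputProb p C σ Y else 0 := by
    simp_rw [← sum_compl_confusable]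
    rw [← sum_outputProb_piFinset, ← Finset.sum_filter]
    refine Finset.sum_le_sum_of_subset_of_nonneg (fun Y hY => ?_)
      fun _ _ _ => outputProb_nonneg hp0 hp1' _ _ _
    refine Finset.mem_filter.2 ⟨Finset.mem_univ _, funext fun i => ?_⟩
    by_contra hne
    exact Finset.mem_compl.1 (Fintype.mem_piFinset.1 hY i)
      (mem_confusable.2 ⟨dec (Y i), Finset.mem_univ _, hne, hdec (Y i) (σ i)⟩)
  have h2 := one_sub_prod_one_sub_le_sum
    (fun i => confusionProb_nonneg hp0 hp1' C Finset.univ (σ i))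
    fun i => confusionProb_le_one hp0 hp1' C Finset.univ (σ i)
  have h3 : ∑ i, confusionProb p C Finset.univ (σ i) ≤ ((m - k : ℕ) : ℝ) * (m * ρD) := by
    refine (Finset.sum_le_card_nsmul _ _ (m * ρD) fun i _ =>
      confusionProb_le hp0 hp1 hρD C _ _ (h (σ i))).trans (by simp)
  have h4 : ((m - k : ℕ) : ℝ) * (m * ρD) ≤ m * (m * ρD) := by
    have h5 : ((m - k : ℕ) : ℝ) ≤ m := by exact_mod_cast Nat.sub_le m k
    gcongr
  have h6 : condErrorProb C p (fun Y i => dec (Y i)) σ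
      ≤ 1 - ∏ i, (1 - confusionProb p C Finset.univ (σ i)) := by
    rw [condErrorProb_eq]
    exact sub_le_sub_left (le_of_le_of_eq h1 (Finset.sum_congr rfl fun Y _ => by congr)) _
  calc _ ≤ _ := h6
    _ ≤ _ := h2
    _ ≤ _ := h3
    _ ≤ _ := h4
    _ = _ := by ring

/-- Chernoff bound on the volume of a Hamming ball of radius slightly below `n / 2`: the ball is
reached with large probability over a channel of crossover probability `1 / (1 + exp (4 ε))`. -/
theorem card_hammingBall_le {n : ℕ} {ε : ℝ} (hε : 0 ≤ ε) (x : Fin n → Bool) :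
    ((Finset.univ.filter fun y : Fin n → Bool =>
      (hammingDist y x : ℝ) < (1 / 2 - ε) * n).card : ℝ) ≤ 2 ^ n * Real.exp (-(2 * ε ^ 2 * n)) := by
  set c := Real.exp (-(4 * ε)) with hc
  have hc0 : 0 < c := Real.exp_pos _
  set B := Finset.univ.filter fun y : Fin n → Bool =>
    (hammingDist y x : ℝ) < (1 / 2 - ε) * n with hB
  have h1 : ∀ y : Fin n → Bool, bscProb (c / (1 + c)) x y = c ^ hammingDist y x / (1 + c) ^ n := by
    intro y
    have h2 : 1 - c / (1 + c) = 1 / (1 + c) := by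
      field_simp
      ring
    have h3 := Nat.add_sub_of_le (hammingDist_le_length y x)
    rw [bscProb, h2, div_pow, div_pow, one_pow, div_mul_div_comm, mul_one, ← pow_add, h3]
  have h2 : (B.card : ℝ) * (Real.exp (-(4 * ε) * ((1 / 2 - ε) * n)) / (1 + c) ^ n) ≤ 1 := by
    rw [← nsmul_eq_mul]
    refine ((Finset.card_nsmul_le_sum B (bscProb (c / (1 + c)) x) _ fun y hy => ?_).trans
      (Finset.sum_le_sum_of_subset_of_nonneg (Finset.subset_univ _) fun y _ _ => ?_)).trans_eq
      (sum_bscProb (c / (1 + c)) x)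
    · rw [h1]
      have h3 := (Finset.mem_filter.1 hy).2
      have h4 : Real.exp (-(4 * ε) * ((1 / 2 - ε) * n)) ≤ c ^ hammingDist y x := by
        rw [hc, ← Real.exp_nat_mul, Real.exp_le_exp]
        nlinarith
      gcongr
    · rw [h1]
      positivity
  have h3 : 1 + c ≤ 2 * Real.exp (-(2 * ε) + 2 * ε ^ 2) := by
    have h4 := Real.cosh_le_exp_half_sq (2 * ε)
    rw [Real.cosh_eq, show (2 * ε) ^ 2 / 2 = 2 * ε ^ 2 by ring] at h4
    have h5 : 1 + c = Real.exp (-(2 * ε)) * (Real.exp (2 * ε) + Real.exp (-(2 * ε))) := by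
      rw [mul_add, ← Real.exp_add, ← Real.exp_add, hc]
      ring_nf
      rw [Real.exp_zero, add_comm]
    rw [h5, Real.exp_add]
    nlinarith [Real.exp_pos (-(2 * ε))]
  have h4 : (1 + c) ^ n ≤ 2 ^ n * Real.exp (n * (-(2 * ε) + 2 * ε ^ 2)) := by
    rw [Real.exp_nat_mul, ← mul_pow]
    exact pow_le_pow_left₀ (by positivity) h3 n
  rw [mul_div_assoc', div_le_one (by positivity)] at h2
  have h5 := h2.trans h4
  have h6 : Real.exp (n * (-(2 * ε) + 2 * ε ^ 2))
      = Real.exp (-(2 * ε ^ 2 * n)) * Real.exp (-(4 * ε) * ((1 / 2 - ε) * n)) := by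
    rw [← Real.exp_add]
    ring_nf
  rw [h6, ← mul_assoc (2 ^ n)] at h5
  exact le_of_mul_le_mul_right h5 (Real.exp_pos _)

/-- The Gilbert–Varshamov greedy construction. -/
theorem exists_codebook {n : ℕ} {D V : ℝ} (hV : 0 ≤ V)
    (h : ∀ x : Fin n → Bool,
      ((Finset.univ.filter fun y : Fin n → Bool => (hammingDist y x : ℝ) < D).card : ℝ) ≤ V)
    (m : ℕ) (hm : m * V ≤ 2 ^ n) :
    ∃ C : Codebook n m, ∀ s t, t ≠ s → D ≤ (hammingDist (C s) (C t) : ℝ) := by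
  classical
  induction m with
  | zero => exact ⟨fun i => i.elim0, fun s => s.elim0⟩
  | succ m ih =>
    have hmV : m * V ≤ 2 ^ n := by
      push_cast at hm
      nlinarith
    obtain ⟨C, hC⟩ := ih hmV
    have hlt : m * V < 2 ^ n := by
      rcases hV.eq_or_lt with rfl | hV0
      · simp
      · push_cast at hm
        nlinarith
    set U := (Finset.univ : Finset (Fin m)).biUnion fun s =>
      Finset.univ.filter fun y : Fin n → Bool => (hammingDist y (C s) : ℝ) < D with hU
    have hUc : U.card < Fintype.card (Fin n → Bool) := by
      have h1 : (U.card : ℝ) ≤ m * V := by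
        have h2 : (U.card : ℝ) ≤ ∑ s : Fin m, ((Finset.univ.filter fun y : Fin n → Bool =>
            (hammingDist y (C s) : ℝ) < D).card : ℝ) := by
          exact_mod_cast Finset.card_biUnion_le
        refine h2.trans ((Finset.sum_le_card_nsmul _ _ V fun s _ => h (C s)).trans (by simp))
      have h3 : (U.card : ℝ) < 2 ^ n := h1.trans_lt hlt
      simp only [Fintype.card_pi, Fintype.card_bool, Finset.prod_const, Finset.card_univ,
        Fintype.card_fin]
      exact_mod_cast h3
    obtain ⟨y, hy⟩ : ∃ y, y ∉ U := by
      by_contra hall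
      push Not at hall
      rw [Finset.eq_univ_iff_forall.2 hall, Finset.card_univ] at hUc
      exact lt_irrefl _ hUc
    have hy' : ∀ s, D ≤ (hammingDist y (C s) : ℝ) := fun s => by
      by_contra hlt'
      exact hy (Finset.mem_biUnion.2 ⟨s, Finset.mem_univ _,
        Finset.mem_filter.2 ⟨Finset.mem_univ _, not_le.1 hlt'⟩⟩)
    refine ⟨Fin.cons y C, fun s t => ?_⟩
    refine Fin.cases ?_ (fun s => ?_) s <;> refine Fin.cases ?_ (fun t => ?_) t
    · exact fun hne => absurd rfl hne
    · exact fun _ => by simpa using hy' t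
    · exact fun _ => by simpa [hammingDist_comm] using hy' s
    · exact fun hne => by simpa using hC s t fun h => hne (by rw [h])

theorem numBees_le {R : ℝ} (hR : 0 ≤ R) (n : ℕ) :
    (numBees R n : ℝ) ≤ (2 : ℝ) ^ ((n : ℝ) * R + 1) := by
  have h1 : (numBees R n : ℝ) < (2 : ℝ) ^ ((n : ℝ) * R) + 1 :=
    Nat.ceil_lt_add_one (Real.rpow_pos_of_pos two_pos _).le
  have h2 : (1 : ℝ) ≤ (2 : ℝ) ^ ((n : ℝ) * R) :=
    Real.one_le_rpow one_le_two (mul_nonneg (Nat.cast_nonneg n) hR)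
  rw [Real.rpow_add two_pos, Real.rpow_one]
  linarith

/-- The choice `ε = √R` in the ball volume leaves room for `2 ^ (n R + 1)` codewords, since the
volume falls short of `2 ^ n` by the factor `exp (2 R n)`. -/
theorem eventually_minErrorProb_le {R p : ℝ} (hR : 0 < R) (hp0 : 0 < p) (hp1 : p < 1 / 2)
    (k : ℕ → ℕ) :
    ∀ᶠ n : ℕ in atTop, minErrorProb n (numBees R n) p (k n)
      ≤ (2 : ℝ) ^ (2 * ((n : ℝ) * R + 1)) *
        Real.sqrt (4 * p * (1 - p)) ^ ((1 / 2 - Real.sqrt R) * n) := by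
  filter_upwards [eventually_ge_atTop ⌈1 / R⌉₊] with n hn
  have hn' : 1 ≤ n * R := (div_le_iff₀ hR).1 (Nat.ceil_le.1 hn)
  have hRR : Real.sqrt R ^ 2 = R := Real.sq_sqrt hR.le
  have hm := numBees_le hR.le n
  have hρ0 := sqrt_four_mul_pos hp0 (show p < 1 by linarith)
  obtain ⟨C, hC⟩ := exists_codebook (n := n) (by positivity)
    (fun x => card_hammingBall_le (Real.sqrt_nonneg R) x) (numBees R n) (by
      have h1 : (2 : ℝ) ^ ((n : ℝ) * R + 1) * Real.exp (-(2 * Real.sqrt R ^ 2 * n)) ≤ 1 := by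
        rw [Real.rpow_def_of_pos two_pos, ← Real.exp_add, Real.exp_le_one_iff, hRR]
        have h2 : Real.log 2 ≤ 1 := by linarith [Real.log_two_lt_d9]
        nlinarith
      calc (numBees R n : ℝ) * (2 ^ n * Real.exp (-(2 * Real.sqrt R ^ 2 * n)))
          ≤ (2 : ℝ) ^ ((n : ℝ) * R + 1) * (2 ^ n * Real.exp (-(2 * Real.sqrt R ^ 2 * n))) := by
            gcongr
        _ = 2 ^ n * ((2 : ℝ) ^ ((n : ℝ) * R + 1) * Real.exp (-(2 * Real.sqrt R ^ 2 * n))) := by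
            ring
        _ ≤ 2 ^ n * 1 := by gcongr
        _ = 2 ^ n := mul_one _)
  refine (minErrorProb_le_sq_mul hp0.le hp1.le (Real.rpow_nonneg hρ0.le _) (numBees_pos R n) C
    (ρD := Real.sqrt (4 * p * (1 - p)) ^ ((1 / 2 - Real.sqrt R) * n)) fun s t hts => ?_).trans ?_
  · rw [← Real.rpow_natCast]
    exact Real.rpow_le_rpow_of_exponent_ge hρ0 sqrt_four_mul_le_one (hC s t hts)
  · have h3 : (2 : ℝ) ^ (2 * ((n : ℝ) * R + 1)) = ((2 : ℝ) ^ ((n : ℝ) * R + 1)) ^ 2 := by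
      rw [mul_comm, Real.rpow_mul two_pos.le, Real.rpow_two]
    rw [h3]
    gcongr

theorem le_exponent {R p α : ℝ} (hR : 0 < R) (hp0 : 0 < p) (hp1 : p < 1 / 2)
    (hα0 : 0 < α) (hα1 : α < 1) :
    (((1 / 2 - Real.sqrt R) * bhattacharyya p - 2 * R : ℝ) : EReal) ≤ exponent R p α := by
  have hlim : Tendsto (fun n : ℕ => (-2) / (n : ℝ) +
      ((1 / 2 - Real.sqrt R) * bhattacharyya p - 2 * R)) atTop
      (𝓝 ((1 / 2 - Real.sqrt R) * bhattacharyya p - 2 * R)) := by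
    have h := (tendsto_const_div_natCast (-2)).add_const
      ((1 / 2 - Real.sqrt R) * bhattacharyya p - 2 * R)
    rwa [zero_add] at h
  refine le_exponent_of_eventually_le hlim ?_
  -- The converse, with `ε = 1`, is used only for positivity: the logarithm of `0` would be `0`.
  filter_upwards [eventually_gt_atTop 0, eventually_le_minErrorProb hR hp0 hp1 hα0 hα1 one_pos,
    eventually_minErrorProb_le hR hp0 hp1 fun n => numAbsent α (numBees R n)] with n hn hn1 hn2
  have hn' : (0 : ℝ) < n := by exact_mod_cast hn
  have hρ0 := sqrt_four_mul_pos hp0 (show p < 1 by linarith)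
  have hpos : 0 < minErrorProb n (numBees R n) p (numAbsent α (numBees R n)) :=
    lt_of_lt_of_le (by positivity) hn1
  have h1 := Real.logb_le_logb_of_le one_lt_two hpos hn2
  have h2 : Real.logb 2 (Real.sqrt (4 * p * (1 - p))) = -bhattacharyya p := by
    rw [bhattacharyya, neg_neg]
  rw [Real.logb_mul (by positivity) (by positivity), Real.logb_rpow two_pos (by norm_num),
    Real.logb_rpow_eq_mul_logb_of_pos hρ0, h2] at h1
  have h3 : (-2) / (n : ℝ) + ((1 / 2 - Real.sqrt R) * bhattacharyya p - 2 * R)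
      = 1 / (n : ℝ) * (-2 + (1 / 2 - Real.sqrt R) * n * bhattacharyya p - 2 * (n * R)) := by
    field_simp
    ring
  rw [h3, neg_mul, ← mul_neg]
  refine mul_le_mul_of_nonneg_left ?_ (by positivity)
  linarith

end Bee

theorem proposition1 (p α : ℝ) (hp0 : 0 < p) (hp1 : p < 1 / 2) (hα0 : 0 < α) (hα1 : α < 1) :
    Tendsto (fun R : ℝ => Bee.exponent R p α) (𝓝[>] 0)
      (𝓝 ((Bee.bhattacharyya p / 2 : ℝ) : EReal)) ∧
    ∀ R : ℝ, Bee.criticalRate p ≤ R → Bee.exponent R p α = 0 := by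
  refine ⟨?_, fun R hR => Bee.exponent_eq_zero_of_criticalRate_le hp0 hp1 hα0 hα1 hR⟩
  have hlow : Tendsto (fun R : ℝ => (1 / 2 - Real.sqrt R) * Bee.bhattacharyya p - 2 * R) (𝓝[>] 0)
      (𝓝 (Bee.bhattacharyya p / 2)) := by
    have h : Continuous fun R : ℝ => (1 / 2 - Real.sqrt R) * Bee.bhattacharyya p - 2 * R := by
      fun_prop
    have h2 := (h.tendsto 0).mono_left (nhdsWithin_le_nhds (s := Set.Ioi 0))
    have h3 : (1 / 2 - Real.sqrt 0) * Bee.bhattacharyya p - 2 * 0 = Bee.bhattacharyya p / 2 := by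
      rw [Real.sqrt_zero]
      ring
    rwa [h3] at h2
  refine tendsto_of_tendsto_of_tendsto_of_le_of_le'
    ((continuous_coe_real_ereal.tendsto _).comp hlow) tendsto_const_nhds ?_ ?_
  · filter_upwards [self_mem_nhdsWithin] with R hR
    exact Bee.le_exponent hR hp0 hp1 hα0 hα1
  · filter_upwards [self_mem_nhdsWithin] with R hR
    exact Bee.exponent_le_half_bhattacharyya hR hp0 hp1 hα0 hα1
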